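/- **Setting.** Let $\mathcal X$ be a set, $\mathcal H\subseteq\{-1,1\}^{\mathcal X}$ a hypothesis class of VC-dimension $d\ge 1$, and $\mathrm{ERM}$ an algorithm that maps every nonempty training sequence realizable by $\mathcal H$ (i.e. consistent with some $h\in\mathcal H$) to a hypothesis in $\mathcal H$ consistent with the sequence. Let $U_T(k)$ be the maximal number of operations $\mathrm{ERM}$ uses on a training sequence of size $k$ realizable by $\mathcal H$, and let $U_I$ be the maximal number of operations needed to evaluate $h(x)$, over all $x\in\mathcal X$ and all $h$ returned by $\mathrm{ERM}$ on a nonempty sequence realizable by $\mathcal H$. All other basic steps (reading or writing an entry, comparing, arithmetic, $\exp$, $\ln$, rounding) cost one operation. **Algorithm (AdaBoostSample).** Input: $S=((x_1,y_1),\dots,(x_m,y_m))\in(\mathcal X\times\{-1,1\})^m$ and $r=(r_1,\dots,r_n)\in([0,1]^s)^n$. Put $t=\lceil 20^2\ln(m)/2\rceil$, $\theta=3/4$, $\gamma=9/20$, $\alpha=\tfrac12\ln\frac{1+2\gamma}{1-2\gamma}-\tfrac12\ln\frac{1+\theta}{1-\theta}$, and let $D_1$ be uniform on $\{1,\dots,m\}$.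 In round $i=1,\dots,n$: - draw $S_i$ of size $s$ by applying $C_i^{-1}$ (found by binary search) to each entry of $r_i$, where $C_i$ is the cumulative distribution function of $D_i$ and $C_i^{-1}(u)$ is the index $l$ with $C_i(l-1)\le u<C_i(l)$; - let $h_i=\mathrm{ERM}(S_i)$ and $\epsilon_i=\sum_{j:\,h_i(x_j)\ne y_j}D_i(j)$; - the round is *successful* if $\epsilon_i\le 1/2-\gamma=1/20$. If so, set $\alpha_i=\alpha$ and, if at most $t$ rounds (this one included) have been successful, store $h_i$ as the next voter. Otherwise set $\alpha_i=0$; - let $D_{i+1}(j)\propto D_i(j)\exp(-\alpha_i h_i(x_j)y_j)$, normalized, and compute $C_{i+1}$. After the loop, if at least $t$ rounds were successful and the *boosted vote* $f=\frac1t\sum_{j=1}^t h_{f,j}$ of the stored voters has no example with $y_jf(x_j)\le\theta$, return $f$; otherwise return the *fallback* $\mathrm{ERM}(S)$. **Theorem.** There is a universal constant $K>0$ such that the following holds for all $\mathcal X,\mathcal H,d,\mathrm{ERM}$ as above. Let $c\in\mathcal H$, $m\ge 2$, $S\in(\mathcal X\times\{-1,1\})^m$ realizable by $c$, $0<\delta<1$,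 $t=\lceil 20^2\ln(m)/2\rceil$, $n\ge 6\lceil 20^2\ln(8m/\delta)/2\rceil$, and let $\mathbf r\sim([0,1]^{550d})^n$ have i.i.d. uniform entries. 1. With probability at least $1-(\delta/(8m))^{20}$ over $\mathbf r$, AdaBoostSample on $(S,\mathbf r)$ has at least $t$ successful rounds (each with error $\epsilon_i\le 1/20$), returns the boosted vote of the hypotheses of $t$ such rounds rather than the fallback $\mathrm{ERM}(S)$, and uses at most $$n\bigl(K\,(m+d\ln m)+U_T(550d)+3m\,U_I\bigr)$$ operations. 2. For every $r\in([0,1]^{550d})^n$ for which AdaBoostSample on $(S,r)$ returns the boosted vote, it uses at most that many operations. -/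

import Mathlib

open MeasureTheory
open scoped ENNReal

noncomputable section

namespace AdaBoostSample

/-! ## Counting operations -/

/-- The result of a computation together with the number of operations it used. -/
structure Timed (α : Type*) where
  val : α
  cost : ℕ

/-- `ops k a`: the value `a`, computed with `k` unit-cost operations (reading or writing an array
entry, comparing, adding, subtracting, multiplying, dividing, `exp`, `ln`, rounding). -/
def ops {α : Type*} (k : ℕ) (a : α) : Timed α := ⟨a, k⟩

/-- Sequential composition; the numbers of operations add up. -/
def Timed.bind {α β : Type*} (x : Timed α) (f : α → Timed β) : Timed β :=
  ⟨(f x.val).val, x.cost + (f x.val).cost⟩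

/-- `for i in 0, …, k - 1`: the body is run on the current state in increasing order of `i`. Each
iteration is charged two operations (increment and test of the counter) on top of its body. -/
def forLoop {σ : Type*} : (k : ℕ) → σ → (Fin k → σ → Timed σ) → Timed σ
  | 0, s, _ => ops 0 s
  | k + 1, s, body =>
    (forLoop k s fun i s' => body i.castSucc s').bind fun s' =>
    (ops 2 s').bind fun s'' => body (Fin.last k) s''

/-! ## Hypothesis classes, training sequences, ERM -/

/-- The labels `{-1, 1}` are the units of `ℤ`; this is the label as a real number. -/
def label (y : ℤˣ) : ℝ := ((y : ℤ) : ℝ)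

/-- `d` is the largest size of a point sequence on which `H` realizes all labelings. -/
def HasVCDim {X : Type*} (H : Set (X → ℤˣ)) (d : ℕ) : Prop :=
  IsGreatest {k : ℕ | ∃ x : Fin k → X, ∀ y : Fin k → ℤˣ, ∃ h ∈ H, ∀ i, h (x i) = y i} d

/-- The training sequence `S` is realizable by the function `h`. -/
def RealizedBy {X : Type*} {k : ℕ} (S : Fin k → X × ℤˣ) (h : X → ℤˣ) : Prop :=
  ∀ i, h (S i).1 = (S i).2

/-- The training sequence `S` is realizable by the class `H`. -/
def RealizableBy {X : Type*} {k : ℕ} (S : Fin k → X × ℤˣ) (H : Set (X → ℤˣ)) : Prop :=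
  ∃ h ∈ H, RealizedBy S h

/-- A learning algorithm: training turns a training sequence into a trained model (a representation
of a hypothesis), inference evaluates a trained model at a point. Both use operations. -/
structure Learner (X : Type*) (M : Type*) where
  train : {k : ℕ} → (Fin k → X × ℤˣ) → Timed M
  infer : M → X → Timed ℤˣ

/-- The hypothesis represented by a trained model. -/
def Learner.hyp {X M : Type*} (L : Learner X M) (h : M) : X → ℤˣ := fun x => (L.infer h x).val

/-- `L` is an ERM algorithm for `H`: on every (nonempty) training sequence that is realizable by
`H` it finds a hypothesis of `H` that is consistent with the sequence. -/
def Learner.IsERM {X M : Type*} (L : Learner X M) (H : Set (X → ℤˣ)) : Prop :=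
  ∀ (k : ℕ) (S : Fin k → X × ℤˣ), 1 ≤ k → RealizableBy S H →
    L.hyp (L.train S).val ∈ H ∧ RealizedBy S (L.hyp (L.train S).val)

/-- Training cost `U_T(k)`: worst case over the training sequences of size `k` that are realizable
by `H`. -/
def Learner.trainCost {X M : Type*} (L : Learner X M) (H : Set (X → ℤˣ)) (k : ℕ) : ℝ≥0∞ :=
  ⨆ (S : Fin k → X × ℤˣ) (_ : RealizableBy S H), ((L.train S).cost : ℝ≥0∞)

/-- Inference cost `U_I`: worst case over all points and all hypotheses trained on a (nonempty)
training sequence that is realizable by `H`. -/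
def Learner.inferCost {X M : Type*} (L : Learner X M) (H : Set (X → ℤˣ)) : ℝ≥0∞ :=
  ⨆ (k : ℕ) (_ : 1 ≤ k) (S : Fin k → X × ℤˣ) (_ : RealizableBy S H) (x : X),
    ((L.infer (L.train S).val x).cost : ℝ≥0∞)

/-- The error of `h` under the distribution that gives weight `D j` to the `j`-th example. -/
def weightedError {X : Type*} {m : ℕ} (S : Fin m → X × ℤˣ) (D : Fin m → ℝ) (h : X → ℤˣ) : ℝ :=
  ∑ j, if h (S j).1 ≠ (S j).2 then D j else 0

/-! ## The algorithm AdaBoostSample -/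

/-- The target margin `θ`. -/
def theta : ℝ := 3 / 4

/-- The target advantage `γ`; a round succeeds when the error is at most `1 / 2 - γ = 1 / 20`. -/
def gamma : ℝ := 9 / 20

/-- The fixed learning rate of a successful round. -/
def learningRate : ℝ :=
  1 / 2 * Real.log ((1 + 2 * gamma) / (1 - 2 * gamma))
    - 1 / 2 * Real.log ((1 + theta) / (1 - theta))

/-- The number `t = ⌈20² ln(m) / 2⌉` of voters. -/
def numVoters (m : ℕ) : ℕ := ⌈(20 : ℝ) ^ 2 * Real.log m / 2⌉₊

section Algorithm

variable {X M : Type*} {m n s t : ℕ}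

/-- Binary search in the array `C` of cumulative sums, between the positions `lo` and `hi`, for the
position `l` with `C (l - 1) ≤ u < C l`. Operations of one call: the test `lo < hi`; then the
addition, halving and rounding for the midpoint, one read, one comparison, and, when the search
goes right, one more addition. -/
def search (C : Fin m → ℝ) (u : ℝ) (lo hi : Fin m) : Timed (Fin m) :=
  if h : lo.val < hi.val then
    if u < C ⟨(lo.val + hi.val) / 2, by omega⟩ then
      (ops 6 ()).bind fun _ => search C u lo ⟨(lo.val + hi.val) / 2, by omega⟩
    else
      (ops 7 ()).bind fun _ => search C u ⟨(lo.val + hi.val) / 2 + 1, by omega⟩ hi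
  else ops 1 lo
termination_by hi.val - lo.val
decreasing_by all_goals omega

/-- `C⁻¹` applied to each entry of `u`: the indices of the examples of the sample `S_i`. -/
def drawIndices [NeZero m] (C : Fin m → ℝ) (u : Fin s → unitInterval) : Timed (Fin s → Fin m) :=
  forLoop s (fun _ => (0 : Fin m)) fun j idx =>
    (ops 1 ((u j : unitInterval) : ℝ)).bind fun v =>
    (search C v 0 ⟨m - 1, Nat.sub_lt (NeZero.pos m) one_pos⟩).bind fun l =>
    ops 1 (Function.update idx j l)

/-- The error of the model `h` under `D`, by one inference per example. -/
def computeError (L : Learner X M) (S : Fin m → X × ℤˣ) (D : Fin m → ℝ) (h : M) : Timed ℝ :=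
  forLoop m 0 fun j acc =>
    (L.infer h (S j).1).bind fun y =>
    -- reading the label, comparing, reading the weight, adding
    ops 4 (if y ≠ (S j).2 then acc + D j else acc)

/-- The new (not yet normalized) weights `D j * exp (-α * h(x_j) * y_j)`, written to a fresh array,
by one inference per example. -/
def reweight (L : Learner X M) (S : Fin m → X × ℤˣ) (D : Fin m → ℝ) (h : M) (α : ℝ) :
    Timed (Fin m → ℝ) :=
  (ops m (fun _ => 0)).bind fun E₀ =>
  forLoop m E₀ fun j E =>
    (L.infer h (S j).1).bind fun y =>
    -- two reads, negation, three multiplications, `exp`, one write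
    ops 8 (Function.update E j (D j * Real.exp (-α * label y * label (S j).2)))

/-- The sum of the entries of an array. -/
def total (D : Fin m → ℝ) : Timed ℝ := forLoop m 0 fun j acc => ops 2 (acc + D j)

/-- Division of all entries of an array by `Z`. -/
def normalize (D : Fin m → ℝ) (Z : ℝ) : Timed (Fin m → ℝ) :=
  forLoop m D fun j E => ops 3 (Function.update E j (E j / Z))

/-- The array of cumulative sums, computed from left to right in a fresh array. -/
def cumulate (D : Fin m → ℝ) : Timed (Fin m → ℝ) :=
  (ops m (fun _ => 0)).bind fun C₀ =>
  (forLoop m (C₀, (0 : ℝ)) fun j st =>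
    -- one read, one addition, one write
    ops 3 (Function.update st.1 j (st.2 + D j), st.2 + D j)).bind fun st => ops 0 st.1

/-- The memory of the algorithm between two rounds: the distribution `D` on the examples, its
cumulative distribution `C`, the number of successful rounds, and the arrays of size `t` that hold
the hypotheses of the first `t` successful rounds (`none` where nothing has been stored, standing
for the function `0`) together with the learning rates, errors, advantages, normalizations and
distributions of these rounds. -/
structure State (M : Type*) (m t : ℕ) where
  D : Fin m → ℝ
  C : Fin m → ℝ
  count : ℕ
  hf : Fin t → Option M
  αf : Fin t → ℝ
  εf : Fin t → ℝ
  γf : Fin t → ℝ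
  Zf : Fin t → ℝ
  Df : Fin t → Fin m → ℝ

/-- The initial memory: the uniform distribution, its cumulative distribution, empty arrays. -/
def initState (M : Type*) (m t : ℕ) : Timed (State M m t) :=
  (ops m (fun _ => 0)).bind fun D₀ =>
  (forLoop m D₀ fun j D => ops 2 (Function.update D j (1 / (m : ℝ)))).bind fun D =>
  (ops m (fun _ => 0)).bind fun C₀ =>
  (forLoop m C₀ fun j C => ops 2 (Function.update C j (((j : ℕ) + 1 : ℝ) / (m : ℝ)))).bind fun C =>
  -- computing `t`; setting `θ`, `γ` and the counter; creating six arrays of size `t`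
  ops (5 + 3 + 6 * t)
    { D := D, C := C, count := 0, hf := fun _ => none, αf := fun _ => 0, εf := fun _ => 0,
      γf := fun _ => 0, Zf := fun _ => 0, Df := fun _ _ => 0 }

/-- The bookkeeping of a round with model `h`, error `ε` and advantage `γ`: it yields the weight
`α` of the round and the updated memory. The hypothesis is stored if at most `t` rounds have been
successful, this one included. -/
def register (st : State M m t) (h : M) (ε γ : ℝ) : Timed (ℝ × State M m t) :=
  -- computing `1 / 2 - gamma`, comparing
  (ops 2 ()).bind fun _ =>
  if ε ≤ 1 / 2 - gamma then
    -- 15 operations for the learning rate, incrementing the counter, comparing it with `t`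
    (ops 17 ()).bind fun _ =>
    if hl : st.count + 1 ≤ t then
      -- five writes
      ops 5 (learningRate,
        { st with
          count := st.count + 1
          hf := Function.update st.hf ⟨st.count, hl⟩ (some h)
          αf := Function.update st.αf ⟨st.count, hl⟩ learningRate
          εf := Function.update st.εf ⟨st.count, hl⟩ ε
          γf := Function.update st.γf ⟨st.count, hl⟩ γ
          Df := Function.update st.Df ⟨st.count, hl⟩ st.D })
    else ops 0 (learningRate, { st with count := st.count + 1 })
  else ops 1 (0, st)

/-- One round of the for loop, on the random numbers `u` of that round. -/
def round [NeZero m] (L : Learner X M) (S : Fin m → X × ℤˣ) (u : Fin s → unitInterval)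
    (st : State M m t) : Timed (State M m t) :=
  (drawIndices st.C u).bind fun idx =>
  (L.train fun j => S (idx j)).bind fun h =>
  (computeError L S st.D h).bind fun ε =>
  (ops 1 (1 / 2 - ε)).bind fun γ =>
  (register st h ε γ).bind fun p =>
  (reweight L S st.D h p.1).bind fun E =>
  (total E).bind fun Z =>
  -- two comparisons (with `1 / 2 - gamma` and with `t`), one write
  (ops 4 (if hl : ε ≤ 1 / 2 - gamma ∧ st.count + 1 ≤ t
    then Function.update p.2.Zf ⟨st.count, hl.2⟩ Z else p.2.Zf)).bind fun Zf =>
  (normalize E Z).bind fun D =>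
  (cumulate D).bind fun C =>
  ops 0 { p.2 with D := D, C := C, Zf := Zf }

/-- The value at `x` of an entry of the array of voters. -/
def evalVoter (L : Learner X M) (x : X) : Option M → Timed ℝ
  | none => ops 1 0
  | some h => (L.infer h x).bind fun y => ops 1 (label y)

/-- The number of examples on which the vote `∑ j, f j / t` has margin at most `θ`. -/
def marginErrors (L : Learner X M) (S : Fin m → X × ℤˣ) (f : Fin t → Option M) : Timed ℕ :=
  forLoop m 0 fun i bad =>
    (forLoop t (0 : ℝ) fun j acc =>
      -- one read of `f`, one of the label, one multiplication, one addition
      (evalVoter L (S i).1 (f j)).bind fun v => ops 4 (acc + v * label (S i).2)).bind fun a =>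
    -- dividing, comparing, incrementing
    ops 3 (if a / (t : ℝ) ≤ theta then bad + 1 else bad)

/-- What the algorithm returns: either the boosted vote `x ↦ ∑ j, f j x / t` with voters `f`,
or, as a fallback, the single hypothesis that was trained on the whole training sequence. -/
inductive Output (M : Type*) (t : ℕ) where
  | boosted (f : Fin t → Option M)
  | fallback (h : M)

/-- Training on the whole training sequence. -/
def runFallback (L : Learner X M) (S : Fin m → X × ℤˣ) : Timed (Output M t) :=
  (L.train S).bind fun h => ops 1 (Output.fallback h)

/-- The memory after the first `k` rounds on the random string `r`. -/
def afterRounds [NeZero m] (L : Learner X M) (S : Fin m → X × ℤˣ)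
    (r : Fin n → Fin s → unitInterval) (k : ℕ) (hk : k ≤ n) : Timed (State M m (numVoters m)) :=
  (initState M m (numVoters m)).bind fun st₀ =>
  forLoop k st₀ fun i st => round L S (r (Fin.castLE hk i)) st

/-- AdaBoostSample on the training sequence `S` and the random string `r`. -/
def adaBoostSample [NeZero m] (L : Learner X M) (S : Fin m → X × ℤˣ)
    (r : Fin n → Fin s → unitInterval) : Timed (Output M (numVoters m)) :=
  -- reading the lengths of `S`, `r` and `r 0` by a pass over the input
  (ops (m + n * s) ()).bind fun _ =>
  (afterRounds L S r n le_rfl).bind fun st =>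
  (ops 1 ()).bind fun _ =>
  if numVoters m ≤ st.count then
    -- writing down the normalized vote
    (forLoop (numVoters m) (fun _ => none) fun j f =>
      ops 2 (Function.update f j (st.hf j))).bind fun f =>
    (marginErrors L S f).bind fun bad =>
    (ops 3 ()).bind fun _ =>
    if (bad : ℝ) / (m : ℝ) < 1 / (m : ℝ) then ops 1 (Output.boosted f)
    else runFallback L S
  else runFallback L S

/-- The distribution `D_i` on the examples at the start of round `i`. -/
def roundDist [NeZero m] (L : Learner X M) (S : Fin m → X × ℤˣ)
    (r : Fin n → Fin s → unitInterval) (i : Fin n) : Fin m → ℝ :=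
  (afterRounds L S r i i.isLt.le).val.D

/-- The model `h_i` that is trained in round `i`. -/
def roundModel [NeZero m] (L : Learner X M) (S : Fin m → X × ℤˣ)
    (r : Fin n → Fin s → unitInterval) (i : Fin n) : M :=
  (L.train fun j => S
    ((drawIndices (afterRounds L S r i i.isLt.le).val.C (r i)).val j)).val

/-- In the run on `r`, at least `t` rounds are successful (the model of the round has error at most
`1 / 20` under the distribution of the round), and the algorithm returns the boosted vote of the
models of `t` such rounds (distinct, in their order), not the fallback. -/
def BoostingSucceeds [NeZero m] (L : Learner X M) (S : Fin m → X × ℤˣ)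
    (r : Fin n → Fin s → unitInterval) : Prop :=
  ∃ i : Fin (numVoters m) → Fin n, StrictMono i ∧
    (∀ j, weightedError S (roundDist L S r (i j)) (L.hyp (roundModel L S r (i j))) ≤ 1 / 20) ∧
    (adaBoostSample L S r).val = Output.boosted fun j => some (roundModel L S r (i j))

end Algorithm

/-- The bound `n * (K * (m + d * ln m) + U_T(550 d) + 3 m U_I)`. -/
def costBound {X M : Type*} (L : Learner X M) (H : Set (X → ℤˣ)) (d m n : ℕ) (K : ℝ) : ℝ≥0∞ :=
  (n : ℝ≥0∞) * (ENNReal.ofReal (K * ((m : ℝ) + (d : ℝ) * Real.log m))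
    + L.trainCost H (550 * d) + 3 * (m : ℝ≥0∞) * L.inferCost H)

end AdaBoostSample

end

/-!
The proof has three parts: a round of AdaBoostSample succeeds with probability at least one half
whatever the current distribution is; `⌈20² ln(m) / 2⌉` successful rounds always yield a vote with
margin more than `3 / 4` on every example; and the operations of each round can be added up.

*Success of a round.* Given the distribution `D` on the examples, binary search in the cumulative
sums turns uniform numbers into independent draws from `D` (`volume_drawIndices_le`). The model of
the round is consistent with the sample, so it can only fail if the sample misses one of the sets
of indices on which a hypothesis of the class errs and which has weight more than `1 / 20`. That
this has probability at most one half for `550 d` draws (`sum_missing_le_half`) is the double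
sample argument of Vapnik and Chervonenkis, carried out with finite sums: a second sample of the
same size hits the missed set at least `13 d` times with probability at least `9 / 10`; averaged
over all exchanges of corresponding entries of the two samples, each trace of a set on the double
sample contributes at most `2 ^ (-13 d)`; and by the Sauer–Shelah lemma there are at most
`(1100 e) ^ d` traces.

*Number of successful rounds.* Since the bound on a round holds for every state of the memory, the
exponential moment `E[2 ^ (-count)]` shrinks by the factor `3 / 4` in each round
(`lintegral_count_le`, by integrating out the last round first), and Markov's inequality bounds the
probability of fewer than `n / 6` successes. Models and hypotheses carry no σ-algebra, so
measurability is handled through functions with countably many values and measurable preimages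
(`IsElementary`).

*Margins.* With `exp α = √(19 / 7)`, a successful round multiplies the normalized exponential loss
of the vote by at most `2 / 5 * exp α`; failed rounds leave the distribution unchanged, and rounds
after the last voter has been stored do not affect the vote (`Invariant`). As
`(2 / 5 * exp α) * exp (3 α / 4) ≤ exp (-1 / 100)`, an example with margin at most `3 / 4` would
have a loss exceeding the total loss (`Invariant.theta_lt_margin`). So the vote is returned
whenever enough rounds succeed.

*Operations.* A round uses one training, two inferences per example, `O(m)` steps for the arrays
and `550 d` binary searches of depth `O(ln m)`. Checking the margins takes one inference per voter
and example, which is the third inference in the bound because there are at most `n` voters.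
-/

namespace AdaBoostSample

/-! ### Loops, their values and their costs -/

@[simp] lemma ops_val {α : Type*} (k : ℕ) (a : α) : (ops k a).val = a := rfl

@[simp] lemma ops_cost {α : Type*} (k : ℕ) (a : α) : (ops k a).cost = k := rfl

@[simp] lemma bind_val {α β : Type*} (x : Timed α) (f : α → Timed β) :
    (x.bind f).val = (f x.val).val := rfl

@[simp] lemma bind_cost {α β : Type*} (x : Timed α) (f : α → Timed β) :
    (x.bind f).cost = x.cost + (f x.val).cost := rfl

lemma forLoop_succ_val {σ : Type*} (k : ℕ) (s : σ) (body : Fin (k + 1) → σ → Timed σ) :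
    (forLoop (k + 1) s body).val
      = (body (Fin.last k) (forLoop k s fun i s' => body i.castSucc s').val).val := rfl

/-- A loop invariant, indexed by the number of completed iterations, that also bounds the cost of
the body. -/
lemma forLoop_spec {σ : Type*} (P : ℕ → σ → Prop) (c : ℕ) :
    ∀ (k : ℕ) (s : σ) (body : Fin k → σ → Timed σ), P 0 s →
      (∀ (i : Fin k) (s' : σ), P i s' → P (i + 1) (body i s').val ∧ (body i s').cost ≤ c) →
      P k (forLoop k s body).val ∧ (forLoop k s body).cost ≤ k * (c + 2)
  | 0, s, body, h0, _ => ⟨h0, by simp [forLoop]⟩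
  | k + 1, s, body, h0, hs => by
    obtain ⟨h1, h2⟩ := forLoop_spec P c k s (fun i s' => body i.castSucc s') h0
      fun i s' h => hs i.castSucc s' h
    obtain ⟨h3, h4⟩ := hs (Fin.last k) _ h1
    refine ⟨h3, ?_⟩
    have : (forLoop (k + 1) s body).cost = (forLoop k s fun i s' => body i.castSucc s').cost
      + (2 + (body (Fin.last k) (forLoop k s fun i s' => body i.castSucc s').val).cost) := rfl
    rw [this, add_mul]
    omega

lemma forLoop_invariant {σ : Type*} (P : ℕ → σ → Prop) (k : ℕ) (s : σ)
    (body : Fin k → σ → Timed σ) (h0 : P 0 s)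
    (hs : ∀ (i : Fin k) (s' : σ), P i s' → P (i + 1) (body i s').val) :
    P k (forLoop k s body).val := by
  induction k with
  | zero => exact h0
  | succ k ih => exact hs (Fin.last k) _ (ih _ fun i s' h => hs i.castSucc s' h)

/-- A loop that overwrites the entries of an array one after the other. -/
lemma forLoop_update_val {k : ℕ} {β : Type*} (s g : Fin k → β)
    (body : Fin k → (Fin k → β) → Timed (Fin k → β))
    (hb : ∀ i s', s' i = s i → (body i s').val = Function.update s' i (g i)) :
    (forLoop k s body).val = g := by
  have := forLoop_invariant
    (fun j (s' : Fin k → β) => ∀ i : Fin k, s' i = if i.val < j then g i else s i) k s body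
    (fun i => by simp) (fun i s' h l => by
      rw [hb i s' (by simpa using h i)]
      rcases eq_or_ne l i with rfl | hl
      · simp
      · have : (l : ℕ) ≠ i := fun e => hl (Fin.ext e)
        rw [Function.update_of_ne hl, h l]
        have : (l.val < i.val + 1) = (l.val < i.val) := by
          apply propext; omega
        simp [this])
  funext i
  simpa using this i

lemma sum_lt_add_ite {k : ℕ} (g : Fin k → ℝ) (j : Fin k) :
    (∑ i, if i.val < j.val + 1 then g i else 0)
      = (∑ i, if i.val < j.val then g i else 0) + g j := by
  have h : g j = ∑ i, if i = j then g i else 0 := by simp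
  rw [h, ← Finset.sum_add_distrib]
  refine Finset.sum_congr rfl fun i _ => ?_
  rcases lt_trichotomy i j with hl | rfl | hl
  · have h1 : i.val < j.val := hl
    simp [h1, hl.ne, h1.trans (Nat.lt_succ_self _)]
  · simp
  · have h1 : j.val < i.val := hl
    simp [hl.ne', h1.not_gt, show ¬ i.val < j.val + 1 by omega]

/-- A loop that adds up numbers. -/
lemma forLoop_sum_val {k : ℕ} (g : Fin k → ℝ) (body : Fin k → ℝ → Timed ℝ)
    (hb : ∀ i a, (body i a).val = a + g i) : (forLoop k 0 body).val = ∑ i, g i := by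
  have := forLoop_invariant (fun j (a : ℝ) => a = ∑ i : Fin k, if i.val < j then g i else 0)
    k 0 body (by simp) (fun i a h => by rw [hb, h, sum_lt_add_ite])
  simpa using this

lemma forLoop_cost_le {σ : Type*} (k : ℕ) (s : σ) (body : Fin k → σ → Timed σ) (c : ℕ)
    (h : ∀ i s', (body i s').cost ≤ c) : (forLoop k s body).cost ≤ k * (c + 2) :=
  (forLoop_spec (fun _ _ => True) c k s body trivial fun i s' _ => ⟨trivial, h i s'⟩).2

/-! ### The subroutines -/

section Subroutines

variable {X M : Type*} {m t s : ℕ}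

lemma search_cost_le (C : Fin m → ℝ) (u : ℝ) (p : ℕ) (lo hi : Fin m) (h : hi.val - lo.val < 2 ^ p) :
    (search C u lo hi).cost ≤ 7 * p + 1 := by
  induction p generalizing lo hi with
  | zero =>
    rw [search, dif_neg (by simp at h; omega)]
    simp
  | succ p ih =>
    rw [search]
    split_ifs with h1 h2
    · have := ih lo ⟨(lo.val + hi.val) / 2, by omega⟩ (by simp only; rw [pow_succ] at h; omega)
      simp only [bind_cost, ops_cost]; omega
    · have := ih ⟨(lo.val + hi.val) / 2 + 1, by omega⟩ hi (by simp only; rw [pow_succ] at h; omega)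
      simp only [bind_cost, ops_cost]; omega
    · simp

/-- Binary search in a monotone array returns the first position whose entry exceeds `u`, if it is
known to lie in the current range. -/
lemma search_spec {C : Fin m → ℝ} (hC : Monotone C) (u : ℝ) (lo hi : Fin m) (hle : lo ≤ hi)
    (hlo : ∀ i < lo, C i ≤ u) (hhi : u < C hi) :
    (∀ i < (search C u lo hi).val, C i ≤ u) ∧ u < C (search C u lo hi).val := by
  induction lo, hi using search.induct C u with
  | case1 lo hi h h1 ih =>
    rw [search, dif_pos h, if_pos h1]
    exact ih (by rw [Fin.le_def]; simp only; omega) hlo h1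
  | case2 lo hi h h1 ih =>
    rw [search, dif_pos h, if_neg h1]
    refine ih (by rw [Fin.le_def]; simp only; omega) (fun i hi' => ?_) hhi
    refine (hC (?_ : i ≤ ⟨(lo.val + hi.val) / 2, by omega⟩)).trans (not_lt.1 h1)
    rw [Fin.lt_def] at hi'
    rw [Fin.le_def]
    simp only at hi' ⊢
    omega
  | case3 lo hi h =>
    rw [search, dif_neg h]
    have : lo = hi := le_antisymm hle (by rw [Fin.le_def]; omega)
    exact ⟨hlo, this ▸ hhi⟩

lemma drawIndices_val [NeZero m] (C : Fin m → ℝ) (u : Fin s → unitInterval) :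
    (drawIndices C u).val =
      fun j => (search C (u j) 0 ⟨m - 1, Nat.sub_lt (NeZero.pos m) one_pos⟩).val :=
  forLoop_update_val _ _ _ fun _ _ _ => rfl

lemma drawIndices_cost_le [NeZero m] (C : Fin m → ℝ) (u : Fin s → unitInterval) {p : ℕ}
    (hp : m ≤ 2 ^ p) : (drawIndices C u).cost ≤ s * (7 * p + 5) := by
  refine forLoop_cost_le _ _ _ (7 * p + 3) fun j idx => ?_
  have := search_cost_le C (u j) p 0 ⟨m - 1, Nat.sub_lt (NeZero.pos m) one_pos⟩ (by
    have := NeZero.pos m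
    simp; omega)
  simp only [bind_cost, ops_cost, ops_val]
  omega

lemma computeError_val (L : Learner X M) (S : Fin m → X × ℤˣ) (D : Fin m → ℝ) (h : M) :
    (computeError L S D h).val = weightedError S D (L.hyp h) := by
  refine forLoop_sum_val _ _ fun i a => ?_
  simp only [bind_val, ops_val, Learner.hyp]
  by_cases hne : (L.infer h (S i).1).val = (S i).2 <;> simp [hne]

lemma computeError_cost_le (L : Learner X M) (S : Fin m → X × ℤˣ) (D : Fin m → ℝ) (h : M) {I : ℕ}
    (hI : ∀ x, (L.infer h x).cost ≤ I) : (computeError L S D h).cost ≤ m * (I + 6) := by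
  refine forLoop_cost_le _ _ _ (I + 4) fun j idx => ?_
  have := hI (S j).1
  simp only [bind_cost, ops_cost]
  omega

lemma reweight_val (L : Learner X M) (S : Fin m → X × ℤˣ) (D : Fin m → ℝ) (h : M) (α : ℝ) :
    (reweight L S D h α).val =
      fun j => D j * Real.exp (-α * label (L.hyp h (S j).1) * label (S j).2) :=
  forLoop_update_val _ _ _ fun _ _ _ => rfl

lemma reweight_cost_le (L : Learner X M) (S : Fin m → X × ℤˣ) (D : Fin m → ℝ) (h : M) (α : ℝ)
    {I : ℕ} (hI : ∀ x, (L.infer h x).cost ≤ I) : (reweight L S D h α).cost ≤ m * (I + 11) := by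
  have h1 := forLoop_cost_le m (fun _ => (0 : ℝ)) (fun j E =>
    (L.infer h (S j).1).bind fun y =>
    ops 8 (Function.update E j (D j * Real.exp (-α * label y * label (S j).2)))) (I + 8)
    fun j idx => by
      have := hI (S j).1
      simp only [bind_cost, ops_cost]
      omega
  have h2 : (reweight L S D h α).cost = m + _ := rfl
  rw [h2]
  refine (Nat.add_le_add_left h1 m).trans (le_of_eq ?_)
  ring

lemma total_val (D : Fin m → ℝ) : (total D).val = ∑ j, D j :=
  forLoop_sum_val _ _ fun _ _ => rfl

lemma total_cost_le (D : Fin m → ℝ) : (total D).cost ≤ m * 4 :=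
  forLoop_cost_le _ _ _ 2 fun _ _ => le_rfl

lemma normalize_val (D : Fin m → ℝ) (Z : ℝ) : (normalize D Z).val = fun j => D j / Z :=
  forLoop_update_val _ _ _ fun i s' h => by rw [ops_val, h]

lemma normalize_cost_le (D : Fin m → ℝ) (Z : ℝ) : (normalize D Z).cost ≤ m * 5 :=
  forLoop_cost_le _ _ _ 3 fun _ _ => le_rfl

/-- The cumulative sums of `D`, each including the entry at its own position. -/
def cumSum (D : Fin m → ℝ) (j : Fin m) : ℝ := ∑ i, if i ≤ j then D i else 0

lemma cumulate_val (D : Fin m → ℝ) : (cumulate D).val = cumSum D := by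
  have := forLoop_invariant
    (fun j (st : (Fin m → ℝ) × ℝ) => (∀ i : Fin m, i.val < j → st.1 i = cumSum D i) ∧
      st.2 = ∑ i : Fin m, if i.val < j then D i else 0)
    m (fun _ => 0, (0 : ℝ))
    (fun j st => ops 3 (Function.update st.1 j (st.2 + D j), st.2 + D j))
    ⟨fun i hi => absurd hi (by simp), by simp⟩ (by
      rintro i st ⟨h1, h2⟩
      have h3 : st.2 + D i = ∑ l : Fin m, if l.val < i.val + 1 then D l else 0 := by
        rw [h2, sum_lt_add_ite]
      refine ⟨fun l hl => ?_, h3⟩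
      rcases eq_or_ne l i with rfl | hne
      · simp only [ops_val, Function.update_self, h3, cumSum, Nat.lt_succ_iff, Fin.le_def]
      · have h4 : (l : ℕ) ≠ i := fun e => hne (Fin.ext e)
        simp only [ops_val, Function.update_of_ne hne, h1 l (by omega)])
  funext i
  exact this.1 i i.isLt

lemma cumulate_cost_le (D : Fin m → ℝ) : (cumulate D).cost ≤ m * 6 := by
  have h1 := forLoop_cost_le m ((fun _ => 0, (0 : ℝ)) : (Fin m → ℝ) × ℝ)
    (fun j st => ops 3 (Function.update st.1 j (st.2 + D j), st.2 + D j)) 3 fun _ _ => le_rfl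
  have h2 : (cumulate D).cost = m + (_ + 0) := rfl
  rw [h2]
  refine (Nat.add_le_add_left h1 m).trans (le_of_eq ?_)
  ring

lemma initState_val : ((initState M m t).val : State M m t) =
    { D := fun _ => 1 / m, C := fun j => ((j : ℕ) + 1 : ℝ) / m, count := 0, hf := fun _ => none,
      αf := fun _ => 0, εf := fun _ => 0, γf := fun _ => 0, Zf := fun _ => 0,
      Df := fun _ _ => 0 } := by
  have h1 : (forLoop m (fun _ => (0 : ℝ)) fun j D =>
      ops 2 (Function.update D j (1 / (m : ℝ)))).val = fun _ => 1 / (m : ℝ) :=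
    forLoop_update_val _ _ _ fun _ _ _ => rfl
  have h2 : (forLoop m (fun _ => (0 : ℝ)) fun j C =>
      ops 2 (Function.update C j (((j : ℕ) + 1 : ℝ) / (m : ℝ)))).val
        = fun j : Fin m => ((j : ℕ) + 1 : ℝ) / m :=
    forLoop_update_val _ _ _ fun _ _ _ => rfl
  simp only [initState, bind_val, ops_val, h1, h2]

lemma initState_cost_le : (initState M m t).cost ≤ 10 * m + 8 + 6 * t := by
  have h1 := forLoop_cost_le m (fun _ => (0 : ℝ)) (fun j D =>
      ops 2 (Function.update D j (1 / (m : ℝ)))) 2 fun _ _ => le_rfl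
  have h2 := forLoop_cost_le m (fun _ => (0 : ℝ)) (fun j C =>
      ops 2 (Function.update C j (((j : ℕ) + 1 : ℝ) / (m : ℝ)))) 2 fun _ _ => le_rfl
  simp only [initState, bind_cost, ops_cost, ops_val]
  omega

lemma register_cost_le (st : State M m t) (h : M) (ε γ : ℝ) : (register st h ε γ).cost ≤ 24 := by
  unfold register
  split_ifs <;> simp

/-- The value at `x` of an entry of the array of voters, without its cost. -/
def voterValue (L : Learner X M) (x : X) : Option M → ℝ
  | none => 0
  | some h => label (L.hyp h x)

lemma evalVoter_val (L : Learner X M) (x : X) (o : Option M) :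
    (evalVoter L x o).val = voterValue L x o := by
  cases o <;> rfl

/-- The unnormalized margin of the vote with voters `f` on the example `e`. -/
def margin (L : Learner X M) (f : Fin t → Option M) (e : X × ℤˣ) : ℝ :=
  ∑ j, voterValue L e.1 (f j) * label e.2

lemma marginErrors_val_eq_zero (L : Learner X M) (S : Fin m → X × ℤˣ) (f : Fin t → Option M)
    (h : ∀ i, theta < margin L f (S i) / t) : (marginErrors L S f).val = 0 := by
  refine forLoop_invariant (fun _ (b : ℕ) => b = 0) m 0 _ rfl fun i b hb => ?_
  have h1 : (forLoop t (0 : ℝ) fun j acc => (evalVoter L (S i).1 (f j)).bind fun v =>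
      ops 4 (acc + v * label (S i).2)).val = margin L f (S i) :=
    forLoop_sum_val _ _ fun j a => by rw [bind_val, ops_val, evalVoter_val]
  simp only [bind_val, ops_val, h1]
  rw [if_neg (not_le.2 (h i)), hb]

lemma marginErrors_cost_le (L : Learner X M) (S : Fin m → X × ℤˣ) (f : Fin t → Option M) {I : ℕ}
    (hI : ∀ j h, f j = some h → ∀ x, (L.infer h x).cost ≤ I) :
    (marginErrors L S f).cost ≤ m * (t * (I + 7) + 5) := by
  refine forLoop_cost_le _ _ _ (t * (I + 7) + 3) fun i b => ?_
  have h1 := forLoop_cost_le t (0 : ℝ) (fun j acc => (evalVoter L (S i).1 (f j)).bind fun v =>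
      ops 4 (acc + v * label (S i).2)) (I + 5) fun j a => by
    rw [bind_cost, ops_cost]
    have : (evalVoter L (S i).1 (f j)).cost ≤ I + 1 := by
      cases h : f j with
      | none => simp [evalVoter]
      | some g =>
        have := hI j g h (S i).1
        simp only [evalVoter, bind_cost, ops_cost]; omega
    omega
  have h2 : t * (I + 5 + 2) = t * (I + 7) := rfl
  simp only [bind_cost, ops_cost]
  omega

end Subroutines

/-! ### A uniform deviation bound for samples from a finite distribution -/

section EpsilonNet

variable {α ι κ : Type*}

/-- The permutation of two copies of `ι` that exchanges the two copies of `i` whenever `σ i`. -/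
def swapCopies (σ : ι → Bool) : Equiv.Perm (ι ⊕ ι) :=
  Function.Involutive.toPerm
    (fun | .inl i => if σ i then .inr i else .inl i
         | .inr i => if σ i then .inl i else .inr i)
    (by rintro (i | i) <;> cases h : σ i <;> simp [h])

lemma swapCopies_inl (σ : ι → Bool) (i : ι) :
    swapCopies σ (.inl i) = if σ i then .inr i else .inl i := rfl

lemma swapCopies_inr (σ : ι → Bool) (i : ι) :
    swapCopies σ (.inr i) = if σ i then .inl i else .inr i := rfl

variable [Fintype ι] [DecidableEq ι] [Fintype κ] [DecidableEq κ]

lemma sum_prod_eq_one [Fintype α] {D : α → ℝ} (hD : ∑ a, D a = 1) :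
    ∑ z : ι → α, ∏ i, D (z i) = 1 := by
  classical
  have h := Finset.prod_univ_sum (fun _ : ι => (Finset.univ : Finset α)) (fun _ a => D a)
  rw [Fintype.piFinset_univ] at h
  rw [← h]; simp [hD]

/-- The traces `{i | w i ∈ A}`, for `A` in the family `𝒜`, on a sequence of points `w`. -/
def traces [DecidableEq α] (𝒜 : Finset (Finset α)) (w : κ → α) : Finset (Finset κ) :=
  𝒜.image fun A => Finset.univ.filter fun i => w i ∈ A

/-- `d` bounds the length of the point sequences on which the family `𝒜` cuts out every subset. -/
def VCDimLE (𝒜 : Finset (Finset α)) (d : ℕ) : Prop :=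
  ∀ (k : ℕ) (x : Fin k → α), (∀ T : Set (Fin k), ∃ A ∈ 𝒜, ∀ i, x i ∈ A ↔ i ∈ T) → k ≤ d

lemma VCDimLE.vcDim_traces_le [DecidableEq α] {𝒜 : Finset (Finset α)} {d : ℕ} (h : VCDimLE 𝒜 d)
    (w : κ → α) : (traces 𝒜 w).vcDim ≤ d := by
  refine Finset.sup_le fun T hT => ?_
  rw [Finset.mem_shatterer] at hT
  refine h T.card (fun i => w (T.equivFin.symm i)) fun U => ?_
  classical
  obtain ⟨u, hu, hTu⟩ := @hT (T.filter fun j => ∃ i, i ∈ U ∧ (T.equivFin.symm i : κ) = j)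
    (Finset.filter_subset _ _)
  obtain ⟨A, hA, rfl⟩ := Finset.mem_image.1 hu
  refine ⟨A, hA, fun i => ?_⟩
  have := Finset.ext_iff.1 hTu (T.equivFin.symm i)
  simpa [Subtype.ext_iff.symm] using this

/-- A version of the Sauer–Shelah bound `∑_{k ≤ d} (N choose k) ≤ (eN/d)^d`. -/
lemma sum_choose_le (d : ℕ) {c : ℝ} (hc : 1 ≤ c) {N : ℕ} (hN : (N : ℝ) = c * d) :
    ((∑ k ∈ Finset.Iic d, N.choose k : ℕ) : ℝ) ≤ (c * Real.exp 1) ^ d := by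
  have hc0 : 0 < c := by linarith
  -- each binomial coefficient with `k ≤ d` is weighted with `c ^ (d - k) ≥ 1`
  have h1 : ((∑ k ∈ Finset.Iic d, N.choose k : ℕ) : ℝ)
      ≤ ∑ k ∈ Finset.Iic d, c ^ d * ((1 / c) ^ k * (N.choose k : ℝ)) := by
    push_cast
    refine Finset.sum_le_sum fun k hk => ?_
    have hk' : k ≤ d := Finset.mem_Iic.1 hk
    have : 1 ≤ c ^ d * (1 / c) ^ k := by
      rw [one_div, inv_pow, ← div_eq_mul_inv, one_le_div (by positivity)]
      exact pow_le_pow_right₀ hc hk'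
    rw [← mul_assoc]
    exact le_mul_of_one_le_left (by positivity) this
  have h2 : ∑ k ∈ Finset.Iic d, c ^ d * ((1 / c) ^ k * (N.choose k : ℝ))
      ≤ c ^ d * (1 / c + 1) ^ N := by
    rw [← Finset.mul_sum, add_pow]
    refine mul_le_mul_of_nonneg_left ?_ (by positivity)
    have h0 : ∀ k ∉ Finset.range (N + 1), (1 / c) ^ k * (N.choose k : ℝ) = 0 := by
      intro k hk
      rw [Nat.choose_eq_zero_of_lt (by simpa using hk)]; simp
    calc ∑ k ∈ Finset.Iic d, (1 / c) ^ k * (N.choose k : ℝ)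
        ≤ ∑ k ∈ Finset.Iic d ∪ Finset.range (N + 1), (1 / c) ^ k * (N.choose k : ℝ) :=
          Finset.sum_le_sum_of_subset_of_nonneg Finset.subset_union_left
            fun _ _ _ => by positivity
      _ = ∑ k ∈ Finset.range (N + 1), (1 / c) ^ k * (N.choose k : ℝ) :=
          (Finset.sum_subset Finset.subset_union_right fun k _ hk => h0 k hk).symm
      _ ≤ _ := le_of_eq (Finset.sum_congr rfl fun k _ => by simp)
  have h3 : (1 / c + 1) ^ N ≤ Real.exp 1 ^ d := by
    calc (1 / c + 1) ^ N ≤ Real.exp (1 / c) ^ N :=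
          pow_le_pow_left₀ (by positivity) (Real.add_one_le_exp _) _
      _ = Real.exp 1 ^ d := by
          rw [← Real.exp_nat_mul, ← Real.exp_nat_mul, hN]
          congr 1; field_simp
  calc _ ≤ _ := h1
    _ ≤ _ := h2
    _ ≤ c ^ d * Real.exp 1 ^ d := mul_le_mul_of_nonneg_left h3 (by positivity)
    _ = _ := (mul_pow _ _ _).symm

lemma card_traces_le [DecidableEq α] {𝒜 : Finset (Finset α)} {d : ℕ} (h : VCDimLE 𝒜 d)
    (w : κ → α) {c : ℝ} (hc : 1 ≤ c) (hκ : (Fintype.card κ : ℝ) = c * d) :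
    ((traces 𝒜 w).card : ℝ) ≤ (c * Real.exp 1) ^ d := by
  refine le_trans ?_ (sum_choose_le d hc hκ)
  have h1 := Finset.card_le_card_shatterer (traces 𝒜 w)
  have h2 := Finset.card_shatterer_le_sum_vcDim (𝒜 := traces 𝒜 w)
  have h3 : ∑ k ∈ Finset.Iic (traces 𝒜 w).vcDim, (Fintype.card κ).choose k
      ≤ ∑ k ∈ Finset.Iic d, (Fintype.card κ).choose k :=
    Finset.sum_le_sum_of_subset (Finset.Iic_subset_Iic.2 (h.vcDim_traces_le w))
  exact_mod_cast h1.trans (h2.trans h3)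

/-- If `T` has `k` indices in the second copy after the swap and none in the first, then all of
these swaps are forced. -/
lemma card_swapCopies_le (T : Finset (ι ⊕ ι)) (k : ℕ) :
    (Finset.univ.filter fun σ : ι → Bool => (∀ i, swapCopies σ (.inl i) ∉ T) ∧
      k ≤ (Finset.univ.filter fun i => swapCopies σ (.inr i) ∈ T).card).card * 2 ^ k
      ≤ 2 ^ Fintype.card ι := by
  rcases Finset.eq_empty_or_nonempty (Finset.univ.filter fun σ : ι → Bool =>
    (∀ i, swapCopies σ (.inl i) ∉ T) ∧
      k ≤ (Finset.univ.filter fun i => swapCopies σ (.inr i) ∈ T).card) with h | ⟨σ₀, hσ₀⟩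
  · rw [h]; simp
  obtain ⟨-, h1, h2⟩ := Finset.mem_filter.1 hσ₀
  set I := Finset.univ.filter fun i => swapCopies σ₀ (.inr i) ∈ T with hI
  -- a swap that keeps `T` out of the first copy agrees with `σ₀` on `I`
  have hsub : (Finset.univ.filter fun σ : ι → Bool => (∀ i, swapCopies σ (.inl i) ∉ T) ∧
      k ≤ (Finset.univ.filter fun i => swapCopies σ (.inr i) ∈ T).card) ⊆
      Fintype.piFinset fun i => if i ∈ I then {σ₀ i} else Finset.univ := by
    intro σ hσ
    obtain ⟨-, h3, -⟩ := Finset.mem_filter.1 hσ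
    refine Fintype.mem_piFinset.2 fun i => ?_
    by_cases hi : i ∈ I
    · have h4 := (Finset.mem_filter.1 hi).2
      have h5 := h3 i
      rw [swapCopies_inr] at h4
      rw [swapCopies_inl] at h5
      rw [if_pos hi, Finset.mem_singleton]
      cases h6 : σ i <;> cases h7 : σ₀ i <;> simp_all
    · simp [hi]
  have hcard := Finset.card_le_card hsub
  rw [Fintype.card_piFinset] at hcard
  have hprod : (∏ i, (if i ∈ I then {σ₀ i} else Finset.univ : Finset Bool).card) * 2 ^ I.card
      = 2 ^ Fintype.card ι := by
    have : (2 : ℕ) ^ I.card = ∏ i, if i ∈ I then 2 else 1 := by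
      rw [Finset.prod_ite_mem, Finset.univ_inter, Finset.prod_const]
    rw [this, ← Finset.prod_mul_distrib, ← Finset.card_univ, ← Finset.prod_const]
    refine Finset.prod_congr rfl fun i _ => ?_
    by_cases hi : i ∈ I <;> simp [hi]
  calc _ ≤ (∏ i, (if i ∈ I then {σ₀ i} else Finset.univ : Finset Bool).card) * 2 ^ I.card :=
        Nat.mul_le_mul hcard (Nat.pow_le_pow_right two_pos h2)
    _ = _ := hprod

/-- The event that some set of `𝒜` misses the first half of a double sample and is hit at least
`k` times by the second half. -/
def MissHit (𝒜 : Finset (Finset α)) (k : ℕ) (w : ι ⊕ ι → α) : Prop :=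
  ∃ A ∈ 𝒜, ∃ I : Finset ι, k ≤ I.card ∧ (∀ i, w (.inl i) ∉ A) ∧ ∀ i ∈ I, w (.inr i) ∈ A

open Classical in
lemma card_missHit_swap_le {𝒜 : Finset (Finset α)} {k : ℕ} (w : ι ⊕ ι → α) :
    (Finset.univ.filter fun σ : ι → Bool => MissHit 𝒜 k (w ∘ swapCopies σ)).card * 2 ^ k
      ≤ (traces 𝒜 w).card * 2 ^ Fintype.card ι := by
  have hsub : (Finset.univ.filter fun σ : ι → Bool => MissHit 𝒜 k (w ∘ swapCopies σ)) ⊆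
      (traces 𝒜 w).biUnion fun T => Finset.univ.filter fun σ : ι → Bool =>
        (∀ i, swapCopies σ (.inl i) ∉ T) ∧
          k ≤ (Finset.univ.filter fun i => swapCopies σ (.inr i) ∈ T).card := by
    intro σ hσ
    obtain ⟨A, hA, I, hI, h1, h2⟩ := (Finset.mem_filter.1 hσ).2
    refine Finset.mem_biUnion.2 ⟨_, Finset.mem_image_of_mem _ hA, ?_⟩
    refine Finset.mem_filter.2 ⟨Finset.mem_univ _, fun i => ?_, hI.trans (Finset.card_le_card ?_)⟩
    · simpa using h1 i
    · intro i hi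
      simpa using h2 i hi
  calc _ ≤ (∑ T ∈ traces 𝒜 w, (Finset.univ.filter fun σ : ι → Bool =>
        (∀ i, swapCopies σ (.inl i) ∉ T) ∧
          k ≤ (Finset.univ.filter fun i => swapCopies σ (.inr i) ∈ T).card).card) * 2 ^ k :=
        Nat.mul_le_mul_right _ ((Finset.card_le_card hsub).trans Finset.card_biUnion_le)
    _ = ∑ T ∈ traces 𝒜 w, (Finset.univ.filter fun σ : ι → Bool =>
        (∀ i, swapCopies σ (.inl i) ∉ T) ∧
          k ≤ (Finset.univ.filter fun i => swapCopies σ (.inr i) ∈ T).card).card * 2 ^ k :=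
        Finset.sum_mul _ _ _
    _ ≤ ∑ T ∈ traces 𝒜 w, 2 ^ Fintype.card ι := Finset.sum_le_sum fun T _ => card_swapCopies_le T k
    _ = _ := by simp

open Classical in
/-- The symmetrization step: averaging over all swaps. -/
lemma sum_missHit_le [Fintype α] {𝒜 : Finset (Finset α)} {k : ℕ} {D : α → ℝ}
    (hD0 : ∀ a, 0 ≤ D a) (hD1 : ∑ a, D a = 1) {G : ℝ}
    (hG : ∀ w : ι ⊕ ι → α, ((traces 𝒜 w).card : ℝ) ≤ G) :
    (∑ w : ι ⊕ ι → α, if MissHit 𝒜 k w then ∏ i, D (w i) else 0) * 2 ^ k ≤ G := by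
  set P := ∑ w : ι ⊕ ι → α, if MissHit 𝒜 k w then ∏ i, D (w i) else 0 with hP
  have hinv : ∀ σ : ι → Bool, P = ∑ w : ι ⊕ ι → α,
      if MissHit 𝒜 k (w ∘ swapCopies σ) then ∏ i, D (w i) else 0 := by
    intro σ
    rw [hP, ← Equiv.sum_comp (Equiv.arrowCongr (swapCopies σ).symm (Equiv.refl α))]
    refine Finset.sum_congr rfl fun w _ => ?_
    have : (∏ i, D ((Equiv.arrowCongr (swapCopies σ).symm (Equiv.refl α)) w i)) = ∏ i, D (w i) :=
      Equiv.prod_comp (swapCopies σ) fun i => D (w i)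
    rw [this]
    rfl
  have havg : 2 ^ Fintype.card ι * P = ∑ w : ι ⊕ ι → α, (∏ i, D (w i)) *
      ((Finset.univ.filter fun σ : ι → Bool => MissHit 𝒜 k (w ∘ swapCopies σ)).card : ℝ) := by
    have : 2 ^ Fintype.card ι * P = ∑ _σ : ι → Bool, P := by simp
    rw [this, Finset.sum_congr rfl fun σ _ => hinv σ, Finset.sum_comm]
    refine Finset.sum_congr rfl fun w _ => ?_
    rw [← Finset.sum_filter, Finset.sum_const, nsmul_eq_mul, mul_comm]
  have hle : 2 ^ Fintype.card ι * (P * 2 ^ k) ≤ 2 ^ Fintype.card ι * G := by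
    calc 2 ^ Fintype.card ι * (P * 2 ^ k) = ∑ w : ι ⊕ ι → α, (∏ i, D (w i)) *
        (((Finset.univ.filter fun σ : ι → Bool => MissHit 𝒜 k (w ∘ swapCopies σ)).card : ℝ)
          * 2 ^ k) := by
          rw [← mul_assoc, havg, Finset.sum_mul]
          exact Finset.sum_congr rfl fun w _ => by ring
      _ ≤ ∑ w : ι ⊕ ι → α, (∏ i, D (w i)) * (G * 2 ^ Fintype.card ι) := by
          refine Finset.sum_le_sum fun w _ => mul_le_mul_of_nonneg_left ?_
            (Finset.prod_nonneg fun i _ => hD0 _)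
          have h1 : (((Finset.univ.filter fun σ : ι → Bool =>
              MissHit 𝒜 k (w ∘ swapCopies σ)).card : ℝ) * 2 ^ k)
              ≤ (traces 𝒜 w).card * 2 ^ Fintype.card ι := by
            exact_mod_cast card_missHit_swap_le w
          exact h1.trans (mul_le_mul_of_nonneg_right (hG w) (by positivity))
      _ = 2 ^ Fintype.card ι * G := by
          rw [← Finset.sum_mul, sum_prod_eq_one hD1]; ring
  exact le_of_mul_le_mul_left hle (by positivity)

open Classical in
/-- A lower tail bound by the exponential moment `E[2 ^ (-hits)]`. -/
lemma sum_few_hits_le [Fintype α] {A : Finset α} {D : α → ℝ} (hD0 : ∀ a, 0 ≤ D a)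
    (hD1 : ∑ a, D a = 1) {p : ℝ} (hp : p ≤ ∑ a ∈ A, D a) (k : ℕ) :
    (∑ z : ι → α, if (Finset.univ.filter fun i => z i ∈ A).card < k then ∏ i, D (z i) else 0)
      ≤ 2 ^ k * (1 - p / 2) ^ Fintype.card ι := by
  have hmgf : ∑ z : ι → α, ∏ i, (D (z i) * if z i ∈ A then 1 / 2 else 1)
      = (1 - (∑ a ∈ A, D a) / 2) ^ Fintype.card ι := by
    have h := Finset.prod_univ_sum (fun _ : ι => (Finset.univ : Finset α))
      (fun _ a => D a * if a ∈ A then (1 / 2 : ℝ) else 1)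
    rw [Fintype.piFinset_univ] at h
    rw [← h, Finset.prod_const, Finset.card_univ]
    congr 1
    have : ∀ a, (D a * if a ∈ A then (1 / 2 : ℝ) else 1)
        = D a - (if a ∈ A then D a else 0) / 2 := by
      intro a; split_ifs <;> ring
    rw [Finset.sum_congr rfl fun a _ => this a, Finset.sum_sub_distrib, hD1, ← Finset.sum_div,
      Finset.sum_ite_mem, Finset.univ_inter]
  have hq1 : ∑ a ∈ A, D a ≤ 1 :=
    hD1 ▸ Finset.sum_le_sum_of_subset_of_nonneg (Finset.subset_univ _) fun a _ _ => hD0 a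
  calc _ ≤ ∑ z : ι → α, 2 ^ k * ∏ i, (D (z i) * if z i ∈ A then 1 / 2 else 1) := by
        refine Finset.sum_le_sum fun z _ => ?_
        have h0 : 0 ≤ ∏ i, D (z i) := Finset.prod_nonneg fun i _ => hD0 _
        have h1 : ∏ i, (D (z i) * if z i ∈ A then (1 / 2 : ℝ) else 1)
            = (∏ i, D (z i)) * (1 / 2) ^ (Finset.univ.filter fun i => z i ∈ A).card := by
          rw [Finset.prod_mul_distrib, ← Finset.prod_filter, Finset.prod_const]
        rw [h1]
        split_ifs with h
        · have h2 : (1 : ℝ) ≤ 2 ^ k * (1 / 2) ^ (Finset.univ.filter fun i => z i ∈ A).card := by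
            rw [one_div, inv_pow, ← div_eq_mul_inv, one_le_div (by positivity)]
            exact pow_le_pow_right₀ one_le_two h.le
          nlinarith
        · positivity
    _ = 2 ^ k * (1 - (∑ a ∈ A, D a) / 2) ^ Fintype.card ι := by rw [← Finset.mul_sum, hmgf]
    _ ≤ _ := by gcongr; linarith

open Classical in
/-- The double sample bound. The second factor is a lower bound for the probability that the second
sample hits a given set of weight more than `p` at least `k` times; dividing by it turns a bound for
double samples into one for samples that miss a set of weight more than `p`. -/
lemma sum_missing_le [Fintype α] {𝒜 : Finset (Finset α)} {k : ℕ} {D : α → ℝ}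
    (hD0 : ∀ a, 0 ≤ D a) (hD1 : ∑ a, D a = 1) {G p : ℝ}
    (hG : ∀ w : ι ⊕ ι → α, ((traces 𝒜 w).card : ℝ) ≤ G) :
    (∑ z : ι → α, if ∃ A ∈ 𝒜, p < ∑ a ∈ A, D a ∧ ∀ i, z i ∉ A then ∏ i, D (z i) else 0)
      * (1 - 2 ^ k * (1 - p / 2) ^ Fintype.card ι) * 2 ^ k ≤ G := by
  refine le_trans (mul_le_mul_of_nonneg_right ?_ (by positivity)) (sum_missHit_le hD0 hD1 hG)
  rw [← Equiv.sum_comp (Equiv.sumArrowEquivProdArrow ι ι α).symm, Fintype.sum_prod_type,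
    Finset.sum_mul]
  refine Finset.sum_le_sum fun z _ => ?_
  have h0 : ∀ z : ι → α, 0 ≤ ∏ i, D (z i) := fun z => Finset.prod_nonneg fun i _ => hD0 _
  have hprod : ∀ z' : ι → α, ∏ i, D ((Equiv.sumArrowEquivProdArrow ι ι α).symm (z, z') i)
      = (∏ i, D (z i)) * ∏ i, D (z' i) := fun z' => by
    rw [Fintype.prod_sum_type]; rfl
  simp only [hprod]
  split_ifs with h
  · obtain ⟨A, hA, hp, hz⟩ := h
    have htail := sum_few_hits_le (ι := ι) hD0 hD1 hp.le k
    have hone : ∑ z' : ι → α, ∏ i, D (z' i) = 1 := sum_prod_eq_one hD1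
    calc _ ≤ (∏ i, D (z i)) * (∑ z' : ι → α, (∏ i, D (z' i)) - ∑ z' : ι → α,
          if (Finset.univ.filter fun i => z' i ∈ A).card < k then ∏ i, D (z' i) else 0) := by
          rw [hone]
          exact mul_le_mul_of_nonneg_left (by linarith) (h0 z)
      _ = ∑ z' : ι → α, (∏ i, D (z i)) * ((∏ i, D (z' i)) -
          if (Finset.univ.filter fun i => z' i ∈ A).card < k then ∏ i, D (z' i) else 0) := by
          rw [← Finset.sum_sub_distrib, Finset.mul_sum]
      _ ≤ _ := by
          refine Finset.sum_le_sum fun z' _ => ?_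
          by_cases hk : (Finset.univ.filter fun i => z' i ∈ A).card < k
          · rw [if_pos hk, sub_self, mul_zero]
            split_ifs
            · exact mul_nonneg (h0 _) (h0 _)
            · exact le_rfl
          · rw [if_neg hk, sub_zero, if_pos]
            refine ⟨A, hA, _, not_lt.1 hk, hz, fun i hi => ?_⟩
            exact (Finset.mem_filter.1 hi).2
  · rw [zero_mul]
    refine Finset.sum_nonneg fun z' _ => ?_
    split_ifs
    · exact mul_nonneg (h0 _) (h0 _)
    · exact le_rfl

open Classical in
/-- With `550 d` examples, a sample hits all sets of weight more than `1 / 20` of a family of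
VC-dimension at most `d` with probability at least one half. -/
theorem sum_missing_le_half [Fintype α] {𝒜 : Finset (Finset α)} {d : ℕ} (hd : 1 ≤ d)
    (h𝒜 : VCDimLE 𝒜 d) {D : α → ℝ} (hD0 : ∀ a, 0 ≤ D a) (hD1 : ∑ a, D a = 1) :
    (∑ z : Fin (550 * d) → α,
      if ∃ A ∈ 𝒜, 1 / 20 < ∑ a ∈ A, D a ∧ ∀ i, z i ∉ A then ∏ i, D (z i) else 0) ≤ 1 / 2 := by
  have hcard : ∀ w : Fin (550 * d) ⊕ Fin (550 * d) → α,
      ((traces 𝒜 w).card : ℝ) ≤ (1100 * Real.exp 1) ^ d := fun w =>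
    card_traces_le h𝒜 w (by norm_num) (by simp; ring)
  have hmain := sum_missing_le (k := 13 * d) (p := 1 / 20) hD0 hD1 hcard
  set P := ∑ z : Fin (550 * d) → α,
      if ∃ A ∈ 𝒜, 1 / 20 < ∑ a ∈ A, D a ∧ ∀ i, z i ∉ A then ∏ i, D (z i) else 0
  have hP : 0 ≤ P := Finset.sum_nonneg fun z _ => by
    split_ifs
    · exact Finset.prod_nonneg fun i _ => hD0 _
    · exact le_rfl
  have htail : (2 : ℝ) ^ (13 * d) * (1 - 1 / 20 / 2) ^ Fintype.card (Fin (550 * d)) ≤ 1 / 10 := by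
    rw [Fintype.card_fin, pow_mul, pow_mul, ← mul_pow]
    have h : (2 : ℝ) ^ 13 * (1 - 1 / 20 / 2) ^ 550 ≤ 1 / 10 := by
      have h55 : (1 - 1 / 20 / 2 : ℝ) ^ 55 ≤ 1 / 4 := by norm_num
      have h550 : (1 - 1 / 20 / 2 : ℝ) ^ 550 ≤ (1 / 4) ^ 10 := by
        rw [show 550 = 55 * 10 from rfl, pow_mul]
        exact pow_le_pow_left₀ (pow_nonneg (by norm_num) _) h55 10
      calc (2 : ℝ) ^ 13 * (1 - 1 / 20 / 2) ^ 550 ≤ 2 ^ 13 * (1 / 4) ^ 10 :=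
            mul_le_mul_of_nonneg_left h550 (by norm_num)
        _ ≤ 1 / 10 := by norm_num
    have h0 : (0 : ℝ) ≤ 2 ^ 13 * (1 - 1 / 20 / 2) ^ 550 :=
      mul_nonneg (by norm_num) (pow_nonneg (by norm_num) _)
    exact (pow_le_of_le_one h0 (h.trans (by norm_num)) (by omega)).trans h
  have hexp : (1100 * Real.exp 1) ^ d ≤ 2 / 5 * (2 : ℝ) ^ (13 * d) := by
    have h : 1100 * Real.exp 1 / 2 ^ 13 ≤ 2 / 5 := by
      have := Real.exp_one_lt_d9
      rw [div_le_iff₀ (by positivity)]; norm_num at this ⊢; linarith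
    have h2 : (1100 * Real.exp 1 / 2 ^ 13) ^ d ≤ 2 / 5 :=
      (pow_le_of_le_one (by positivity) (h.trans (by norm_num)) (by omega)).trans h
    rwa [div_pow, ← pow_mul, div_le_iff₀ (by positivity)] at h2
  have hpos : (0 : ℝ) < 2 ^ (13 * d) := by positivity
  have h1 := le_of_mul_le_mul_right (hmain.trans hexp) hpos
  have h2 := mul_le_mul_of_nonneg_left htail hP
  rw [mul_sub, mul_one] at h1
  linarith

end EpsilonNet

/-! ### One round of boosting -/

section Round

variable {X M : Type*} {m n s t : ℕ}

/-- The model trained in a round that starts with the cumulative distribution `C` and uses the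
random numbers `u`. -/
noncomputable def drawnModel [NeZero m] (L : Learner X M) (S : Fin m → X × ℤˣ) (C : Fin m → ℝ)
    (u : Fin s → unitInterval) : M :=
  (L.train fun j => S ((drawIndices C u).val j)).val

/-- A round starting in the memory `st` is successful if its model has error at most `1 / 20`. -/
def RoundSucceeds [NeZero m] (L : Learner X M) (S : Fin m → X × ℤˣ) (u : Fin s → unitInterval)
    (st : State M m t) : Prop :=
  weightedError S st.D (L.hyp (drawnModel L S st.C u)) ≤ 1 / 2 - gamma

lemma half_sub_gamma : 1 / 2 - gamma = 1 / 20 := by norm_num [gamma]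

/-- The weights of the examples after a round with model `h` and learning rate `α`. -/
noncomputable def newDist (L : Learner X M) (S : Fin m → X × ℤˣ) (D : Fin m → ℝ) (h : M)
    (α : ℝ) : Fin m → ℝ :=
  fun j => D j * Real.exp (-α * label (L.hyp h (S j).1) * label (S j).2) /
    ∑ l, D l * Real.exp (-α * label (L.hyp h (S l).1) * label (S l).2)

lemma newDist_zero {L : Learner X M} {S : Fin m → X × ℤˣ} {D : Fin m → ℝ} (hD : ∑ j, D j = 1)
    (h : M) : newDist L S D h 0 = D := by
  funext j
  simp [newDist, hD]

lemma register_of_lt {st : State M m t} {h : M} {ε γ : ℝ} (hε : ε ≤ 1 / 2 - gamma)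
    (hl : st.count < t) :
    (register st h ε γ).val.1 = learningRate ∧ (register st h ε γ).val.2.count = st.count + 1 ∧
      (register st h ε γ).val.2.hf = Function.update st.hf ⟨st.count, hl⟩ (some h) := by
  rw [register, bind_val, if_pos hε, bind_val, dif_pos (Nat.succ_le_of_lt hl)]
  exact ⟨rfl, rfl, rfl⟩

lemma register_of_full {st : State M m t} {h : M} {ε γ : ℝ} (hε : ε ≤ 1 / 2 - gamma)
    (hl : t ≤ st.count) :
    (register st h ε γ).val.1 = learningRate ∧ (register st h ε γ).val.2.count = st.count + 1 ∧
      (register st h ε γ).val.2.hf = st.hf := by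
  rw [register, bind_val, if_pos hε, bind_val, dif_neg (by omega)]
  exact ⟨rfl, rfl, rfl⟩

lemma register_of_not_le {st : State M m t} {h : M} {ε γ : ℝ} (hε : ¬ ε ≤ 1 / 2 - gamma) :
    (register st h ε γ).val = (0, st) := by
  rw [register, bind_val, if_neg hε, ops_val]

variable [NeZero m] {L : Learner X M} {S : Fin m → X × ℤˣ} {u : Fin s → unitInterval}
  {st : State M m t}

/-- The result of the bookkeeping step in a round that starts in the memory `st`. -/
noncomputable def registered (L : Learner X M) (S : Fin m → X × ℤˣ) (u : Fin s → unitInterval)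
    (st : State M m t) : ℝ × State M m t :=
  (register st (drawnModel L S st.C u) (weightedError S st.D (L.hyp (drawnModel L S st.C u)))
    (1 / 2 - weightedError S st.D (L.hyp (drawnModel L S st.C u)))).val

lemma round_count : (round L S u st).val.count = (registered L S u st).2.count := by
  rw [registered, ← computeError_val]
  rfl

lemma round_hf : (round L S u st).val.hf = (registered L S u st).2.hf := by
  rw [registered, ← computeError_val]
  rfl

lemma round_C : (round L S u st).val.C = cumSum (round L S u st).val.D := by
  rw [← cumulate_val]
  rfl

lemma round_D : (round L S u st).val.D =
    newDist L S st.D (drawnModel L S st.C u) (registered L S u st).1 := by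
  unfold newDist
  rw [← total_val, ← normalize_val, ← reweight_val, registered, ← computeError_val]
  rfl

lemma round_D_of_succeeds (h : RoundSucceeds L S u st) :
    (round L S u st).val.D = newDist L S st.D (drawnModel L S st.C u) learningRate := by
  rw [round_D]
  rcases lt_or_ge st.count t with hl | hl
  · rw [registered, (register_of_lt h hl).1]
  · rw [registered, (register_of_full h hl).1]

lemma round_D_of_not_succeeds (h : ¬ RoundSucceeds L S u st) :
    (round L S u st).val.D = newDist L S st.D (drawnModel L S st.C u) 0 := by
  rw [round_D, registered, register_of_not_le h]

lemma round_count_of_succeeds (h : RoundSucceeds L S u st) :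
    (round L S u st).val.count = st.count + 1 := by
  rw [round_count]
  rcases lt_or_ge st.count t with hl | hl
  · rw [registered, (register_of_lt h hl).2.1]
  · rw [registered, (register_of_full h hl).2.1]

lemma round_count_of_not_succeeds (h : ¬ RoundSucceeds L S u st) :
    (round L S u st).val.count = st.count := by
  rw [round_count, registered, register_of_not_le h]

lemma round_hf_of_succeeds (h : RoundSucceeds L S u st) (hl : st.count < t) :
    (round L S u st).val.hf =
      Function.update st.hf ⟨st.count, hl⟩ (some (drawnModel L S st.C u)) := by
  rw [round_hf, registered, (register_of_lt h hl).2.2]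

lemma round_hf_of_not_succeeds (h : ¬ RoundSucceeds L S u st) :
    (round L S u st).val.hf = st.hf := by
  rw [round_hf, registered, register_of_not_le h]

lemma round_hf_of_full (hl : t ≤ st.count) : (round L S u st).val.hf = st.hf := by
  by_cases h : RoundSucceeds L S u st
  · rw [round_hf, registered, (register_of_full h hl).2.2]
  · exact round_hf_of_not_succeeds h

end Round

/-! ### The exponential potential -/

lemma label_mul_label (a b : ℤˣ) : label a * label b = if a ≠ b then -1 else 1 := by
  rcases Int.units_eq_one_or a with rfl | rfl <;> rcases Int.units_eq_one_or b with rfl | rfl <;>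
    simp [label]

lemma learningRate_eq : learningRate = 1 / 2 * Real.log (19 / 7) := by
  have h1 : (1 + 2 * gamma) / (1 - 2 * gamma) = 19 := by norm_num [gamma]
  have h2 : (1 + theta) / (1 - theta) = 7 := by norm_num [theta]
  rw [learningRate, h1, h2, Real.log_div (by norm_num) (by norm_num)]
  ring

lemma exp_learningRate_sq : Real.exp learningRate ^ 2 = 19 / 7 := by
  rw [← Real.exp_nat_mul, learningRate_eq]
  have : ((2 : ℕ) : ℝ) * (1 / 2 * Real.log (19 / 7)) = Real.log (19 / 7) := by push_cast; ring
  rw [this, Real.exp_log (by norm_num)]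

lemma learningRate_pos : 0 < learningRate := by
  rw [learningRate_eq]
  have := Real.log_pos (by norm_num : (1 : ℝ) < 19 / 7)
  linarith

/-- The factor by which the potential shrinks (at least) in a successful round: it is
`(1 - ε) exp (-α) + ε exp α` for `ε = 1 / 20` and `exp α = √(19 / 7)`. -/
noncomputable def shrink : ℝ := 2 / 5 * Real.exp learningRate

lemma shrink_pos : 0 < shrink := by unfold shrink; positivity

section Potential

variable {X M : Type*} {m t : ℕ} {L : Learner X M} {S : Fin m → X × ℤˣ}

lemma sum_exp_le_shrink {D : Fin m → ℝ} (hD : ∑ j, D j = 1) {h : X → ℤˣ}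
    (hε : weightedError S D h ≤ 1 / 20) :
    ∑ j, D j * Real.exp (-learningRate * label (h (S j).1) * label (S j).2) ≤ shrink := by
  set q := Real.exp learningRate with hq
  have hq0 : 0 < q := Real.exp_pos _
  have hq1 : 1 < q := Real.one_lt_exp_iff.2 learningRate_pos
  have hq2 : q ^ 2 = 19 / 7 := exp_learningRate_sq
  have hinv : q⁻¹ < 1 := inv_lt_one_of_one_lt₀ hq1
  have hterm : ∀ j, D j * Real.exp (-learningRate * label (h (S j).1) * label (S j).2)
      = q⁻¹ * D j + (q - q⁻¹) * if h (S j).1 ≠ (S j).2 then D j else 0 := by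
    intro j
    rw [mul_assoc, label_mul_label]
    split_ifs
    · rw [neg_mul_neg, mul_one]; ring
    · rw [mul_one, Real.exp_neg]; ring
  rw [Finset.sum_congr rfl fun j _ => hterm j, Finset.sum_add_distrib, ← Finset.mul_sum,
    ← Finset.mul_sum, hD]
  have h1 : (q - q⁻¹) * weightedError S D h ≤ (q - q⁻¹) * (1 / 20) :=
    mul_le_mul_of_nonneg_left hε (by linarith)
  have h2 : q⁻¹ = 7 / 19 * q := by
    field_simp
    linarith
  unfold weightedError at h1
  rw [shrink, ← hq]
  linarith

lemma newDist_eq {D : Fin m → ℝ} {h : M} {α : ℝ} (j : Fin m) :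
    newDist L S D h α j = D j * Real.exp (-α * label (L.hyp h (S j).1) * label (S j).2) /
      ∑ l, D l * Real.exp (-α * label (L.hyp h (S l).1) * label (S l).2) := rfl

lemma sum_exp_pos [NeZero m] {D : Fin m → ℝ} (hD : ∀ j, 0 < D j) (h : M) (α : ℝ) :
    0 < ∑ l, D l * Real.exp (-α * label (L.hyp h (S l).1) * label (S l).2) :=
  Finset.sum_pos (fun l _ => mul_pos (hD l) (Real.exp_pos _)) Finset.univ_nonempty

lemma newDist_pos [NeZero m] {D : Fin m → ℝ} (hD : ∀ j, 0 < D j) (h : M) (α : ℝ) (j : Fin m) :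
    0 < newDist L S D h α j :=
  div_pos (mul_pos (hD j) (Real.exp_pos _)) (sum_exp_pos hD h α)

lemma sum_newDist [NeZero m] {D : Fin m → ℝ} (hD : ∀ j, 0 < D j) (h : M) (α : ℝ) :
    ∑ j, newDist L S D h α j = 1 := by
  simp only [newDist_eq, ← Finset.sum_div]
  exact div_self (sum_exp_pos hD h α).ne'

lemma margin_update {f : Fin t → Option M} {l : Fin t} (hl : f l = none) (h : M) (e : X × ℤˣ) :
    margin L (Function.update f l (some h)) e = margin L f e + label (L.hyp h e.1) * label e.2 := by
  unfold margin
  have : ∀ j, voterValue L e.1 (Function.update f l (some h) j) * label e.2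
      = voterValue L e.1 (f j) * label e.2
        + if j = l then label (L.hyp h e.1) * label e.2 else 0 := by
    intro j
    rcases eq_or_ne j l with rfl | hj
    · simp [hl, voterValue]
    · simp [hj]
  rw [Finset.sum_congr rfl fun j _ => this j, Finset.sum_add_distrib]
  simp

/-- The model `h` was trained on a nonempty training sequence that is realizable by `H`. -/
def IsTrained (L : Learner X M) (H : Set (X → ℤˣ)) (h : M) : Prop :=
  ∃ (k : ℕ) (S : Fin k → X × ℤˣ), 1 ≤ k ∧ RealizableBy S H ∧ h = (L.train S).val

/-- The invariant of the boosting rounds. As long as not all voters have been found, the weight of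
an example is its exponential loss under the voters found so far, up to the common factor `m * W`,
where the potential `W` has shrunk in each successful round. Later rounds change the distribution
but no longer the voters. -/
structure Invariant (L : Learner X M) (H : Set (X → ℤˣ)) (S : Fin m → X × ℤˣ) (st : State M m t) :
    Prop where
  D_pos : ∀ j, 0 < st.D j
  D_sum : ∑ j, st.D j = 1
  C_eq : st.C = cumSum st.D
  hf_none : ∀ l : Fin t, st.count ≤ l → st.hf l = none
  hf_trained : ∀ l h, st.hf l = some h → IsTrained L H h
  potential : st.count ≤ t → ∃ W, 0 < W ∧ W ≤ shrink ^ st.count ∧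
    ∀ j, Real.exp (-learningRate * margin L st.hf (S j)) = m * W * st.D j
  loss_le : ∀ j, Real.exp (-learningRate * margin L st.hf (S j)) ≤ m * shrink ^ min st.count t

lemma loss_le_of_potential {st : State M m t} (hD0 : ∀ j, 0 < st.D j) (hD : ∑ j, st.D j = 1)
    (hc : st.count ≤ t) (h : ∃ W, 0 < W ∧ W ≤ shrink ^ st.count ∧
      ∀ j, Real.exp (-learningRate * margin L st.hf (S j)) = m * W * st.D j) (j : Fin m) :
    Real.exp (-learningRate * margin L st.hf (S j)) ≤ m * shrink ^ min st.count t := by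
  obtain ⟨W, hW0, hW, h⟩ := h
  have h1 : st.D j ≤ 1 :=
    hD ▸ Finset.single_le_sum (fun i _ => (hD0 i).le) (Finset.mem_univ j)
  rw [h j, min_eq_left hc]
  calc (m : ℝ) * W * st.D j ≤ m * W * 1 := by gcongr
    _ ≤ m * shrink ^ st.count := by rw [mul_one]; gcongr

lemma cumSum_uniform (j : Fin m) :
    cumSum (fun _ : Fin m => 1 / (m : ℝ)) j = ((j : ℕ) + 1 : ℝ) / m := by
  unfold cumSum
  rw [← Finset.sum_filter, Finset.sum_const]
  have : (Finset.univ.filter fun i : Fin m => i ≤ j) = Finset.Iic j := by ext; simp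
  rw [this, Fin.card_Iic, nsmul_eq_mul]
  push_cast
  ring

lemma numVoters_ge (m : ℕ) : 200 * Real.log m ≤ numVoters m := by
  refine le_trans (le_of_eq ?_) (Nat.le_ceil _)
  ring

lemma numVoters_pos {m : ℕ} (hm : 2 ≤ m) : 0 < numVoters m := by
  have : (1 : ℝ) < m := by exact_mod_cast hm
  refine Nat.ceil_pos.2 ?_
  have := Real.log_pos this
  positivity

/-- The potential shrinks fast enough for the target margin `3 / 4`. -/
lemma shrink_mul_exp_le : shrink * Real.exp (learningRate * (3 / 4)) ≤ Real.exp (-1 / 100) := by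
  have h8 : (shrink * Real.exp (learningRate * (3 / 4))) ^ 8 = (2 / 5) ^ 8 * (19 / 7) ^ 7 := by
    have h6 : Real.exp (learningRate * (3 / 4)) ^ 8 = Real.exp learningRate ^ 6 := by
      rw [← Real.exp_nat_mul, ← Real.exp_nat_mul]; congr 1; push_cast; ring
    rw [mul_pow, h6, shrink, mul_pow, ← exp_learningRate_sq]
    ring
  have hr : Real.exp (-1 / 100) ^ 8 = Real.exp (-8 / 100) := by
    rw [← Real.exp_nat_mul]; congr 1; push_cast; ring
  have h1 := Real.add_one_le_exp (-8 / 100 : ℝ)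
  refine (pow_le_pow_iff_left₀ (mul_nonneg shrink_pos.le (Real.exp_pos _).le) (Real.exp_pos _).le
    (by norm_num : 8 ≠ 0)).1 ?_
  rw [h8, hr]
  refine le_trans ?_ h1
  norm_num

/-- Once all voters have been found, their vote has margin more than `3 / 4` on all examples. -/
lemma Invariant.theta_lt_margin {H : Set (X → ℤˣ)} {st : State M m (numVoters m)}
    (hst : Invariant L H S st) (hm : 2 ≤ m) (hc : numVoters m ≤ st.count) (j : Fin m) :
    theta < margin L st.hf (S j) / (numVoters m : ℝ) := by
  have ht : (0 : ℝ) < numVoters m := by exact_mod_cast numVoters_pos hm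
  have hm1 : (1 : ℝ) < m := by exact_mod_cast hm
  have hm0 : (0 : ℝ) < m := by linarith
  rw [lt_div_iff₀ ht]
  by_contra hcon
  have h1 := hst.loss_le j
  rw [min_eq_right hc] at h1
  set t := numVoters m
  have h2 : Real.exp (-(learningRate * (3 / 4) * t)) ≤ m * shrink ^ t := by
    refine le_trans (Real.exp_le_exp.2 ?_) h1
    have := mul_le_mul_of_nonneg_left (not_lt.1 hcon) learningRate_pos.le
    unfold theta at this
    linarith
  have h3 : Real.exp (-(learningRate * (3 / 4) * t)) *
      Real.exp (learningRate * (3 / 4)) ^ t = 1 := by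
    rw [← Real.exp_nat_mul, ← Real.exp_add]
    convert Real.exp_zero using 2
    ring
  have h4 : (1 : ℝ) ≤ m * (shrink * Real.exp (learningRate * (3 / 4))) ^ t := by
    rw [← h3, mul_pow, ← mul_assoc]
    gcongr
  have h5 : (shrink * Real.exp (learningRate * (3 / 4))) ^ t ≤ Real.exp (-(2 * Real.log m)) := by
    calc _ ≤ Real.exp (-1 / 100) ^ t :=
          pow_le_pow_left₀ (mul_nonneg shrink_pos.le (Real.exp_pos _).le) shrink_mul_exp_le _
      _ = Real.exp (t * (-1 / 100)) := (Real.exp_nat_mul _ _).symm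
      _ ≤ _ := Real.exp_le_exp.2 (by have := numVoters_ge m; linarith)
  have h6 : (m : ℝ) * Real.exp (-(2 * Real.log m)) = Real.exp (-Real.log m) := by
    nth_rewrite 1 [← Real.exp_log hm0]
    rw [← Real.exp_add]; congr 1; ring
  have h7 : Real.exp (-Real.log m) < 1 := by
    rw [Real.exp_lt_one_iff]
    have := Real.log_pos hm1
    linarith
  have := mul_le_mul_of_nonneg_left h5 hm0.le
  linarith

variable [NeZero m] {H : Set (X → ℤˣ)}

lemma invariant_initState : Invariant L H S (initState M m t).val := by
  have hm : (0 : ℝ) < m := by exact_mod_cast NeZero.pos m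
  have hpot : ((initState M m t).val).count ≤ t → ∃ W, 0 < W ∧
      W ≤ shrink ^ ((initState M m t).val).count ∧
      ∀ j, Real.exp (-learningRate * margin L ((initState M m t).val).hf (S j))
        = m * W * ((initState M m t).val).D j := by
    intro _
    rw [initState_val]
    refine ⟨1, one_pos, by simp, fun j => ?_⟩
    simp [margin, voterValue, hm.ne']
  have hpos : ∀ j, 0 < ((initState M m t).val).D j := by
    rw [initState_val]; intro j; simpa using hm
  have hsum : ∑ j, ((initState M m t).val).D j = 1 := by
    rw [initState_val]; simp [hm.ne']
  refine ⟨hpos, hsum, ?_, ?_, ?_, hpot, ?_⟩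
  · rw [initState_val]; funext j; exact (cumSum_uniform j).symm
  · rw [initState_val]; intros; rfl
  · rw [initState_val]; intro l h hl; exact absurd hl (by simp)
  · exact loss_le_of_potential hpos hsum (by rw [initState_val]; exact Nat.zero_le _)
      (hpot (by rw [initState_val]; exact Nat.zero_le _))

lemma isTrained_drawnModel {c : X → ℤˣ} (hc : c ∈ H) (hS : RealizedBy S c) {s : ℕ} (hs : 1 ≤ s)
    (C : Fin m → ℝ) (u : Fin s → unitInterval) : IsTrained L H (drawnModel L S C u) :=
  ⟨s, _, hs, ⟨c, hc, fun _ => hS _⟩, rfl⟩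

lemma Invariant.round {st : State M m t} (hst : Invariant L H S st) {c : X → ℤˣ} (hc : c ∈ H)
    (hS : RealizedBy S c) {s : ℕ} (hs : 1 ≤ s) (u : Fin s → unitInterval) :
    Invariant L H S (round L S u st).val := by
  by_cases hsucc : RoundSucceeds L S u st
  · have hD := round_D_of_succeeds hsucc
    have hcount := round_count_of_succeeds hsucc
    have hpos : ∀ j, 0 < (AdaBoostSample.round L S u st).val.D j := by
      rw [hD]; exact newDist_pos hst.D_pos _ _
    have hsum : ∑ j, (AdaBoostSample.round L S u st).val.D j = 1 := by
      rw [hD]; exact sum_newDist hst.D_pos _ _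
    by_cases hl : st.count < t
    · have hf := round_hf_of_succeeds hsucc hl
      have hnone : st.hf ⟨st.count, hl⟩ = none := hst.hf_none _ le_rfl
      have hpot : ∃ W, 0 < W ∧ W ≤ shrink ^ (AdaBoostSample.round L S u st).val.count ∧
          ∀ j, Real.exp (-learningRate * margin L (AdaBoostSample.round L S u st).val.hf (S j))
            = m * W * (AdaBoostSample.round L S u st).val.D j := by
        obtain ⟨W, hW0, hW, hexp⟩ := hst.potential hl.le
        have hZ0 := sum_exp_pos (L := L) (S := S) hst.D_pos (drawnModel L S st.C u) learningRate
        have hZ := sum_exp_le_shrink hst.D_sum (hsucc.trans_eq half_sub_gamma)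
        set Z := ∑ l, st.D l * Real.exp (-learningRate *
          label (L.hyp (drawnModel L S st.C u) (S l).1) * label (S l).2) with hZdef
        refine ⟨W * Z, mul_pos hW0 hZ0, ?_, fun j => ?_⟩
        · rw [hcount, pow_succ]
          exact mul_le_mul hW hZ hZ0.le (pow_nonneg shrink_pos.le _)
        · rw [hf, margin_update hnone, mul_add, Real.exp_add, hexp, hD, newDist_eq, ← hZdef,
            ← mul_assoc (-learningRate)]
          field_simp
      refine ⟨hpos, hsum, round_C, fun l hl' => ?_, fun l h hlh => ?_, fun _ => hpot,
        loss_le_of_potential hpos hsum (by rw [hcount]; exact hl) hpot⟩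
      · rw [hcount] at hl'
        rw [hf, Function.update_of_ne (by rintro rfl; simp at hl')]
        exact hst.hf_none l (by omega)
      · rw [hf] at hlh
        rcases eq_or_ne l ⟨st.count, hl⟩ with rfl | hne
        · rw [Function.update_self, Option.some_inj] at hlh
          rw [← hlh]
          exact isTrained_drawnModel hc hS hs _ _
        · rw [Function.update_of_ne hne] at hlh
          exact hst.hf_trained l h hlh
    · have hf := round_hf_of_full (L := L) (S := S) (u := u) (not_lt.1 hl)
      refine ⟨hpos, hsum, round_C, fun l hl' => ?_, ?_, fun h => ?_, ?_⟩
      · have := l.isLt; omega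
      · rw [hf]; exact hst.hf_trained
      · rw [hcount] at h; omega
      · have h1 := hst.loss_le
        rw [min_eq_right (not_lt.1 hl)] at h1
        rw [hf, hcount, min_eq_right (by omega)]
        exact h1
  · have hD := round_D_of_not_succeeds hsucc
    rw [newDist_zero hst.D_sum] at hD
    have hcount := round_count_of_not_succeeds hsucc
    have hf := round_hf_of_not_succeeds hsucc
    refine ⟨?_, ?_, round_C, ?_, ?_, ?_, ?_⟩ <;> simp only [hD, hcount, hf]
    · exact hst.D_pos
    · exact hst.D_sum
    · exact hst.hf_none
    · exact hst.hf_trained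
    · exact hst.potential
    · exact hst.loss_le

end Potential

/-! ### Elementary functions of the random string -/

/-- A function into an arbitrary type (without a σ-algebra) is elementary if it takes countably
many values and all its preimages are measurable. -/
structure IsElementary {Ω β : Type*} [MeasurableSpace Ω] (f : Ω → β) : Prop where
  countable_range : (Set.range f).Countable
  measurableSet_preimage : ∀ B : Set β, MeasurableSet (f ⁻¹' B)

namespace IsElementary

variable {Ω β β' : Type*} [MeasurableSpace Ω]

lemma const (b : β) : IsElementary fun _ : Ω => b :=
  ⟨(Set.countable_singleton b).mono (by rintro _ ⟨_, rfl⟩; rfl), fun _ =>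
    measurable_const (MeasurableSpace.measurableSet_top (α := β))⟩

/-- Elementary functions are closed under sequential composition. -/
lemma bind {f : Ω → β} {g : β → Ω → β'} (hf : IsElementary f) (hg : ∀ b, IsElementary (g b)) :
    IsElementary fun ω => g (f ω) ω := by
  refine ⟨(hf.countable_range.biUnion fun b _ => (hg b).countable_range).mono ?_, fun B => ?_⟩
  · rintro _ ⟨ω, rfl⟩
    exact Set.mem_biUnion ⟨ω, rfl⟩ ⟨ω, rfl⟩
  · have : (fun ω => g (f ω) ω) ⁻¹' B = ⋃ b ∈ Set.range f, f ⁻¹' {b} ∩ g b ⁻¹' B := by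
      ext ω
      simp only [Set.mem_preimage, Set.mem_iUnion, Set.mem_inter_iff, Set.mem_singleton_iff]
      exact ⟨fun h => ⟨f ω, ⟨ω, rfl⟩, rfl, h⟩, fun ⟨b, _, hb, h⟩ => by rw [hb]; exact h⟩
    rw [this]
    exact MeasurableSet.biUnion hf.countable_range fun b _ =>
      (hf.measurableSet_preimage _).inter ((hg b).measurableSet_preimage _)

lemma comp {f : Ω → β} (hf : IsElementary f) (φ : β → β') : IsElementary fun ω => φ (f ω) :=
  hf.bind fun b => const (φ b)

lemma timed_bind (x : Timed β) {g : β → Ω → Timed β'} (hg : IsElementary (g x.val)) :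
    IsElementary fun ω => x.bind fun b => g b ω := by
  have h := hg.comp fun y => (⟨y.val, x.cost + y.cost⟩ : Timed β')
  exact h

lemma prodMk {f : Ω → β} {g : Ω → β'} (hf : IsElementary f) (hg : IsElementary g) :
    IsElementary fun ω => (f ω, g ω) :=
  hf.bind fun b => hg.comp fun b' => (b, b')

lemma pi {k : ℕ} {f : Fin k → Ω → β} (hf : ∀ i, IsElementary (f i)) :
    IsElementary fun ω i => f i ω := by
  have hc : (Set.range fun ω i => f i ω).Countable :=
    (Set.countable_univ_pi fun i => (hf i).countable_range).mono (by
      rintro _ ⟨ω, rfl⟩ i _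
      exact ⟨ω, rfl⟩)
  refine ⟨hc, fun B => ?_⟩
  have : (fun ω i => f i ω) ⁻¹' B
      = ⋃ b ∈ B ∩ Set.range fun ω i => f i ω, ⋂ i, f i ⁻¹' {b i} := by
    ext ω
    simp only [Set.mem_preimage, Set.mem_iUnion, Set.mem_iInter, Set.mem_singleton_iff]
    constructor
    · exact fun h => ⟨_, ⟨h, ω, rfl⟩, fun i => rfl⟩
    · rintro ⟨b, ⟨hb, -⟩, h⟩
      rwa [show (fun i => f i ω) = b from funext h]
  rw [this]
  exact MeasurableSet.biUnion (hc.mono Set.inter_subset_right) fun b _ =>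
    MeasurableSet.iInter fun i => (hf i).measurableSet_preimage _

lemma of_measurableSet {p : Ω → Prop} (hp : MeasurableSet {ω | p ω}) : IsElementary p :=
  ⟨Set.to_countable _, fun _ => (measurableSet_setOfPred.1 hp) MeasurableSpace.measurableSet_top⟩

lemma measurableSet {p : Ω → Prop} (hp : IsElementary p) : MeasurableSet {ω | p ω} := by
  have : {ω | p ω} = p ⁻¹' {True} := by ext; simp
  rw [this]
  exact hp.measurableSet_preimage _

lemma ite {p : Ω → Prop} [∀ ω, Decidable (p ω)] (hp : MeasurableSet {ω | p ω}) {f g : Ω → β}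
    (hf : IsElementary f) (hg : IsElementary g) :
    IsElementary fun ω => if p ω then f ω else g ω := by
  classical
  have := (of_measurableSet hp).bind (g := fun q ω => if q then f ω else g ω) fun q => by
    by_cases hq : q <;> simp only [hq, if_true, if_false]
    · exact hf
    · exact hg
  convert this using 3

lemma measurable {f : Ω → ℝ≥0∞} (hf : IsElementary f) : Measurable f :=
  fun B _ => hf.measurableSet_preimage B

lemma forLoop {k : ℕ} {s : β} {body : Ω → Fin k → β → Timed β}
    (hb : ∀ i b, IsElementary fun ω => body ω i b) :
    IsElementary fun ω => forLoop k s (body ω) := by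
  induction k with
  | zero => exact const _
  | succ k ih =>
    exact (ih (body := fun ω i => body ω i.castSucc) fun i b => hb i.castSucc b).bind
      (g := fun x ω => x.bind fun s' => (ops 2 s').bind fun s'' => body ω (Fin.last k) s'')
      fun x => (hb (Fin.last k) x.val).comp fun y => x.bind fun s' => (ops 2 s').bind fun _ => y

end IsElementary

section Elementary

variable {Ω X M : Type*} [MeasurableSpace Ω] {m n s t : ℕ}

lemma isElementary_search (C : Fin m → ℝ) {v : Ω → ℝ} (hv : Measurable v) (lo hi : Fin m) :
    IsElementary fun ω => search C (v ω) lo hi := by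
  induction hg : hi.val - lo.val using Nat.strong_induction_on generalizing lo hi with
  | _ g ih =>
  by_cases h : lo.val < hi.val
  · have h1 := ih _ (by simp only; omega) lo ⟨(lo.val + hi.val) / 2, by omega⟩ rfl
    have h2 := ih _ (by simp only; omega) ⟨(lo.val + hi.val) / 2 + 1, by omega⟩ hi rfl
    have h3 := IsElementary.ite (p := fun ω => v ω < C ⟨(lo.val + hi.val) / 2, by omega⟩)
      (measurableSet_lt hv measurable_const) (h1.comp fun x => (ops 6 ()).bind fun _ => x)
      (h2.comp fun x => (ops 7 ()).bind fun _ => x)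
    convert h3 using 2 with ω
    conv_lhs => rw [search, dif_pos h]
  · convert IsElementary.const (Ω := Ω) (ops 1 lo) using 2 with ω
    rw [search, dif_neg h]

variable [NeZero m]

lemma isElementary_drawIndices (C : Fin m → ℝ) {u : Ω → Fin s → unitInterval}
    (hu : Measurable u) : IsElementary fun ω => drawIndices C (u ω) :=
  IsElementary.forLoop (body := fun ω j idx => (ops 1 ((u ω j : unitInterval) : ℝ)).bind fun v =>
    (search C v 0 ⟨m - 1, Nat.sub_lt (NeZero.pos m) one_pos⟩).bind fun l =>
    ops 1 (Function.update idx j l)) fun j idx =>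
  (isElementary_search C (measurable_subtype_coe.comp (measurable_pi_iff.1 hu j)) 0
    ⟨m - 1, Nat.sub_lt (NeZero.pos m) one_pos⟩).comp
    fun x => (ops 1 ()).bind fun _ => x.bind fun l => ops 1 (Function.update idx j l)

variable (L : Learner X M) (S : Fin m → X × ℤˣ)

lemma isElementary_drawnModel (C : Fin m → ℝ) {u : Ω → Fin s → unitInterval}
    (hu : Measurable u) : IsElementary fun ω => drawnModel L S C (u ω) :=
  (isElementary_drawIndices C hu).comp fun x => (L.train fun j => S (x.val j)).val

lemma isElementary_round (st : State M m t) {u : Ω → Fin s → unitInterval} (hu : Measurable u) :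
    IsElementary fun ω => round L S (u ω) st := by
  unfold round
  exact (isElementary_drawIndices st.C hu).comp fun x => x.bind _

lemma isElementary_afterRounds (k : ℕ) (hk : k ≤ n) :
    IsElementary fun r : Fin n → Fin s → unitInterval => afterRounds L S r k hk := by
  have hbody : ∀ (i : Fin k) (st : State M m (numVoters m)), IsElementary
      fun r : Fin n → Fin s → unitInterval => round L S (r (Fin.castLE hk i)) st := by
    intro i st
    have hu : Measurable fun r : Fin n → Fin s → unitInterval => r (Fin.castLE hk i) :=
      measurable_pi_apply _
    exact isElementary_round L S st hu
  unfold afterRounds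
  have h := IsElementary.forLoop (s := (initState M m (numVoters m)).val) hbody
  exact IsElementary.timed_bind _ h

lemma isElementary_adaBoostSample :
    IsElementary fun r : Fin n → Fin s → unitInterval => adaBoostSample L S r := by
  unfold adaBoostSample
  exact (isElementary_afterRounds L S n le_rfl).comp
    fun x => (ops (m + n * s) ()).bind fun _ => x.bind _

lemma isElementary_roundDist (i : Fin n) :
    IsElementary fun r : Fin n → Fin s → unitInterval => roundDist L S r i :=
  (isElementary_afterRounds L S i i.isLt.le).comp fun x => x.val.D

lemma isElementary_roundModel (i : Fin n) :
    IsElementary fun r : Fin n → Fin s → unitInterval => roundModel L S r i :=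
  (isElementary_afterRounds L S i i.isLt.le).bind
    (g := fun x r => drawnModel L S x.val.C (r i))
    fun x => isElementary_drawnModel L S x.val.C (measurable_pi_apply _)

lemma measurableSet_boostingSucceeds_and (q : Timed (Output M (numVoters m)) → Prop) :
    MeasurableSet {r : Fin n → Fin s → unitInterval |
      BoostingSucceeds L S r ∧ q (adaBoostSample L S r)} := by
  have h := (IsElementary.pi fun i => isElementary_roundDist (n := n) (s := s) L S i).prodMk
    ((IsElementary.pi fun i => isElementary_roundModel L S i).prodMk
      (isElementary_adaBoostSample L S))
  exact (h.comp fun x => (∃ i : Fin (numVoters m) → Fin n, StrictMono i ∧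
    (∀ j, weightedError S (x.1 (i j)) (L.hyp (x.2.1 (i j))) ≤ 1 / 20) ∧
    x.2.2.val = Output.boosted fun j => some (x.2.1 (i j))) ∧ q x.2.2).measurableSet

end Elementary

/-! ### The law of the samples and the probability of a successful round -/

section Law

variable {X M : Type*} {m n s t : ℕ}

open Classical in
/-- The sets of indices of the examples of `S` on which some hypothesis of `H` errs. -/
noncomputable def errorSets (H : Set (X → ℤˣ)) (S : Fin m → X × ℤˣ) : Finset (Finset (Fin m)) :=
  Finset.univ.filter fun A => ∃ h ∈ H, A = Finset.univ.filter fun j => h (S j).1 ≠ (S j).2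

lemma vcDimLE_errorSets {H : Set (X → ℤˣ)} {d : ℕ} (hd : HasVCDim H d) (S : Fin m → X × ℤˣ) :
    VCDimLE (errorSets H S) d := by
  classical
  intro k x hx
  refine hd.2 ⟨fun i => (S (x i)).1, fun y => ?_⟩
  obtain ⟨A, hA, hAT⟩ := hx {i | y i ≠ (S (x i)).2}
  obtain ⟨h, hH, rfl⟩ := (Finset.mem_filter.1 hA).2
  refine ⟨h, hH, fun i => ?_⟩
  have h1 := hAT i
  simp only [Finset.mem_filter, Finset.mem_univ, true_and, Set.mem_ofPred_eq] at h1
  rcases Int.units_eq_one_or (h (S (x i)).1) with h2 | h2 <;>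
    rcases Int.units_eq_one_or (y i) with h3 | h3 <;>
    rcases Int.units_eq_one_or (S (x i)).2 with h4 | h4 <;>
    simp_all

lemma cumSum_monotone {D : Fin m → ℝ} (hD : ∀ j, 0 ≤ D j) : Monotone (cumSum D) := by
  intro a b hab
  refine Finset.sum_le_sum fun i _ => ?_
  by_cases h : i ≤ a
  · rw [if_pos h, if_pos (h.trans hab)]
  · rw [if_neg h]
    split_ifs
    exacts [hD i, le_rfl]

variable [NeZero m]

lemma cumSum_last {D : Fin m → ℝ} (hD : ∑ j, D j = 1) :
    cumSum D ⟨m - 1, Nat.sub_lt (NeZero.pos m) one_pos⟩ = 1 := by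
  rw [← hD]
  refine Finset.sum_congr rfl fun i _ => if_pos ?_
  rw [Fin.le_def]
  simp only
  omega

/-- Inverting the cumulative distribution function at a uniform random number yields index `l` with
probability (at most) `D l`; the point `1`, at which the search also ends at the last index, is
null. -/
lemma volume_search_le {D : Fin m → ℝ} (hD0 : ∀ j, 0 ≤ D j) (hD : ∑ j, D j = 1) (l : Fin m) :
    volume {v : unitInterval | (search (cumSum D) v 0
      ⟨m - 1, Nat.sub_lt (NeZero.pos m) one_pos⟩).val = l} ≤ ENNReal.ofReal (D l) := by
  have hmono := cumSum_monotone hD0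
  have hnonneg : 0 ≤ cumSum D l - D l := by
    have h1 : D l ≤ cumSum D l := by
      unfold cumSum
      refine le_trans (le_of_eq (if_pos le_rfl).symm) (Finset.single_le_sum
        (f := fun i => if i ≤ l then D i else 0) (fun i _ => ?_) (Finset.mem_univ l))
      change 0 ≤ if i ≤ l then D i else 0
      split_ifs
      exacts [hD0 i, le_rfl]
    linarith
  have hle1 : cumSum D l ≤ 1 := by
    rw [← cumSum_last hD]
    refine hmono ?_
    rw [Fin.le_def]; simp only; omega
  have hsub : {v : unitInterval | (search (cumSum D) v 0
      ⟨m - 1, Nat.sub_lt (NeZero.pos m) one_pos⟩).val = l} ⊆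
      Set.Ico ⟨cumSum D l - D l, hnonneg, by linarith [hD0 l]⟩
        ⟨cumSum D l, by linarith [hD0 l], hle1⟩ ∪ {1} := by
    intro v hv
    rcases eq_or_ne v 1 with rfl | hv1
    · exact Or.inr rfl
    · left
      have hlt : (v : ℝ) < 1 := lt_of_le_of_ne v.2.2 fun h => hv1 (Subtype.ext h)
      obtain ⟨h1, h2⟩ := search_spec hmono v 0 ⟨m - 1, Nat.sub_lt (NeZero.pos m) one_pos⟩
        (by rw [Fin.le_def]; simp) (fun i hi => absurd hi (by simp))
        (by rwa [cumSum_last hD])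
      rw [Set.mem_ofPred_eq] at hv
      rw [hv] at h1 h2
      refine ⟨?_, h2⟩
      change cumSum D l - D l ≤ (v : ℝ)
      have h3 : cumSum D l - D l = ∑ i : Fin m, if i.val < l.val then D i else 0 := by
        rw [sub_eq_iff_eq_add, ← sum_lt_add_ite]
        simp only [cumSum, Fin.le_def, Nat.lt_succ_iff]
      rw [h3]
      rcases Nat.eq_zero_or_pos l.val with h0 | h0
      · simp only [h0, Nat.not_lt_zero, if_false, Finset.sum_const_zero]
        exact v.2.1
      · refine le_trans (le_of_eq ?_)
          (h1 ⟨l.val - 1, by omega⟩ (by rw [Fin.lt_def]; simp only; omega))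
        refine Finset.sum_congr rfl fun i _ => ?_
        have : (i.val < l.val) = (i ≤ (⟨l.val - 1, by omega⟩ : Fin m)) := by
          rw [Fin.le_def]; apply propext; simp only; omega
        simp only [this]
  calc _ ≤ _ := measure_mono hsub
    _ ≤ _ + _ := measure_union_le _ _
    _ = ENNReal.ofReal (D l) := by
      rw [unitInterval.volume_Ico, measure_singleton, add_zero]
      congr 1
      simp

open Classical in
/-- A sample has property `bad` with at most the probability that independent draws from `D`
have it. -/
lemma volume_drawIndices_le {D : Fin m → ℝ} (hD0 : ∀ j, 0 ≤ D j) (hD : ∑ j, D j = 1)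
    (bad : (Fin s → Fin m) → Prop) :
    volume {u : Fin s → unitInterval | bad (drawIndices (cumSum D) u).val} ≤
      ENNReal.ofReal (∑ z, if bad z then ∏ j, D (z j) else 0) := by
  have hsub : {u : Fin s → unitInterval | bad (drawIndices (cumSum D) u).val} ⊆
      ⋃ z ∈ Finset.univ.filter bad, Set.univ.pi fun j => {v : unitInterval |
        (search (cumSum D) v 0 ⟨m - 1, Nat.sub_lt (NeZero.pos m) one_pos⟩).val = z j} := by
    intro u hu
    refine Set.mem_biUnion (x := (drawIndices (cumSum D) u).val) (by simpa using hu) ?_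
    intro j _
    rw [drawIndices_val]
    rfl
  calc _ ≤ _ := measure_mono hsub
    _ ≤ ∑ z ∈ Finset.univ.filter bad, volume (Set.univ.pi fun j => {v : unitInterval |
        (search (cumSum D) v 0 ⟨m - 1, Nat.sub_lt (NeZero.pos m) one_pos⟩).val = z j}) :=
        measure_biUnion_finset_le _ _
    _ ≤ ∑ z ∈ Finset.univ.filter bad, ENNReal.ofReal (∏ j, D (z j)) := by
        refine Finset.sum_le_sum fun z _ => ?_
        rw [volume_pi_pi, ENNReal.ofReal_prod_of_nonneg fun j _ => hD0 _]
        exact Finset.prod_le_prod' fun j _ => volume_search_le hD0 hD (z j)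
    _ = _ := by
        rw [← ENNReal.ofReal_sum_of_nonneg fun z _ => Finset.prod_nonneg fun j _ => hD0 _,
          Finset.sum_filter]

variable {L : Learner X M} {S : Fin m → X × ℤˣ} {H : Set (X → ℤˣ)} {d : ℕ} {c : X → ℤˣ}

lemma volume_not_roundSucceeds_le {st : State M m t} (hst : Invariant L H S st) (hd : 1 ≤ d)
    (hH : HasVCDim H d) (hL : L.IsERM H) (hc : c ∈ H) (hS : RealizedBy S c) :
    volume {u : Fin (550 * d) → unitInterval | ¬ RoundSucceeds L S u st} ≤ 1 / 2 := by
  classical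
  have hhalf := sum_missing_le_half hd (vcDimLE_errorSets hH S) (fun j => (hst.D_pos j).le)
    hst.D_sum
  have hsub : {u : Fin (550 * d) → unitInterval | ¬ RoundSucceeds L S u st} ⊆
      {u | ∃ A ∈ errorSets H S, 1 / 20 < ∑ a ∈ A, st.D a ∧
        ∀ i, (drawIndices (cumSum st.D) u).val i ∉ A} := by
    intro u hu
    obtain ⟨hmem, hreal⟩ := hL (550 * d) (fun j => S ((drawIndices st.C u).val j)) (by omega)
      ⟨c, hc, fun _ => hS _⟩
    refine ⟨_, Finset.mem_filter.2 ⟨Finset.mem_univ _, _, hmem, rfl⟩, ?_, fun i => ?_⟩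
    · have hu' : ¬ RoundSucceeds L S u st := hu
      rw [RoundSucceeds, half_sub_gamma, not_le, weightedError, ← Finset.sum_filter] at hu'
      exact hu'
    · rw [← hst.C_eq]
      simpa using hreal i
  refine (measure_mono hsub).trans
    ((volume_drawIndices_le (fun j => (hst.D_pos j).le) hst.D_sum
      fun z => ∃ A ∈ errorSets H S, 1 / 20 < ∑ a ∈ A, st.D a ∧ ∀ i, z i ∉ A).trans ?_)
  refine (ENNReal.ofReal_le_ofReal (q := 1 / 2) (by convert hhalf)).trans (le_of_eq ?_)
  rw [ENNReal.ofReal_div_of_pos two_pos]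
  simp

/-! ### The number of successful rounds -/

lemma afterRounds_zero_val (r : Fin n → Fin s → unitInterval) :
    (afterRounds L S r 0 (Nat.zero_le n)).val = (initState M m (numVoters m)).val := by
  unfold afterRounds
  rw [bind_val]
  rfl

lemma afterRounds_succ_val (r : Fin n → Fin s → unitInterval) (k : ℕ) (hk : k + 1 ≤ n) :
    (afterRounds L S r (k + 1) hk).val =
      (round L S (r ⟨k, hk⟩) (afterRounds L S r k (Nat.le_of_succ_le hk)).val).val := by
  unfold afterRounds
  rw [bind_val, bind_val, forLoop_succ_val]
  rfl

lemma afterRounds_castSucc (r : Fin (n + 1) → Fin s → unitInterval) :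
    afterRounds L S r n n.le_succ = afterRounds L S (fun i => r i.castSucc) n le_rfl := by
  unfold afterRounds
  rfl

lemma invariant_afterRounds (hc : c ∈ H) (hS : RealizedBy S c) (hs : 1 ≤ s)
    (r : Fin n → Fin s → unitInterval) (k : ℕ) (hk : k ≤ n) :
    Invariant L H S (afterRounds L S r k hk).val := by
  refine forLoop_invariant (fun _ st => Invariant L H S st) k _ _ invariant_initState ?_
  exact fun i st hst => hst.round hc hS hs _

/-- The exponential moment `E[2 ^ (-count)]` shrinks by `3 / 4` in each round. -/
lemma lintegral_round_le {st : State M m t} (hst : Invariant L H S st) (hd : 1 ≤ d)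
    (hH : HasVCDim H d) (hL : L.IsERM H) (hc : c ∈ H) (hS : RealizedBy S c) :
    ∫⁻ u : Fin (550 * d) → unitInterval, (2⁻¹ : ℝ≥0∞) ^ (round L S u st).val.count
      ≤ 3 / 4 * 2⁻¹ ^ st.count := by
  classical
  have hmeas : MeasurableSet {u : Fin (550 * d) → unitInterval | ¬ RoundSucceeds L S u st} :=
    ((isElementary_drawnModel L S st.C measurable_id).comp fun h =>
      ¬ weightedError S st.D (L.hyp h) ≤ 1 / 2 - gamma).measurableSet
  have hpt : ∀ u : Fin (550 * d) → unitInterval,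
      (2⁻¹ : ℝ≥0∞) ^ (round L S u st).val.count = 2⁻¹ ^ st.count * (2⁻¹ +
        {u : Fin (550 * d) → unitInterval | ¬ RoundSucceeds L S u st}.indicator
          (fun _ => 2⁻¹) u) := by
    intro u
    by_cases h : RoundSucceeds L S u st
    · rw [round_count_of_succeeds h, pow_succ, Set.indicator_of_notMem (by simpa using h), add_zero]
    · rw [round_count_of_not_succeeds h, Set.indicator_of_mem (by simpa using h),
        ENNReal.inv_two_add_inv_two, mul_one]
  simp_rw [hpt]
  rw [lintegral_const_mul' _ _ (by finiteness), lintegral_add_left measurable_const,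
    lintegral_indicator_const hmeas, lintegral_const,
    measure_univ, mul_one, mul_comm]
  refine mul_le_mul_left ?_ _
  calc (2⁻¹ : ℝ≥0∞) + 2⁻¹ * volume {u : Fin (550 * d) → unitInterval | ¬ RoundSucceeds L S u st}
      ≤ 2⁻¹ + 2⁻¹ * (1 / 2) := by
        gcongr
        exact volume_not_roundSucceeds_le hst hd hH hL hc hS
    _ = 3 / 4 := by
        rw [← ENNReal.toReal_eq_toReal_iff' (by finiteness) (by finiteness),
          ENNReal.toReal_add (by finiteness) (by finiteness)]
        norm_num

lemma lintegral_count_le (hd : 1 ≤ d) (hH : HasVCDim H d) (hL : L.IsERM H) (hc : c ∈ H)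
    (hS : RealizedBy S c) (n : ℕ) :
    ∫⁻ r : Fin n → Fin (550 * d) → unitInterval,
      (2⁻¹ : ℝ≥0∞) ^ (afterRounds L S r n le_rfl).val.count ≤ (3 / 4) ^ n := by
  induction n with
  | zero =>
    have : ∀ r : Fin 0 → Fin (550 * d) → unitInterval,
        (afterRounds L S r 0 le_rfl).val.count = 0 := by
      intro r
      rw [afterRounds_zero_val, initState_val]
    simp [this]
  | succ n ih =>
    have he := (volume_preserving_piFinSuccAbove
      (fun _ : Fin (n + 1) => Fin (550 * d) → unitInterval) (Fin.last n)).symm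
    have hel : IsElementary fun r : Fin (n + 1) → Fin (550 * d) → unitInterval =>
        (2⁻¹ : ℝ≥0∞) ^ (afterRounds L S r (n + 1) le_rfl).val.count :=
      (isElementary_afterRounds L S (n + 1) le_rfl).comp fun x => 2⁻¹ ^ x.val.count
    rw [← he.lintegral_comp hel.measurable]
    refine (lintegral_prod_symm' _ (hel.measurable.comp he.measurable)).trans_le ?_
    have hstep : ∀ (u : Fin (550 * d) → unitInterval) (r : Fin n → Fin (550 * d) → unitInterval),
        (afterRounds L S ((MeasurableEquiv.piFinSuccAbove
          (fun _ : Fin (n + 1) => Fin (550 * d) → unitInterval) (Fin.last n)).symm (u, r))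
          (n + 1) le_rfl).val = (round L S u (afterRounds L S r n le_rfl).val).val := by
      intro u r
      set w := (MeasurableEquiv.piFinSuccAbove
          (fun _ : Fin (n + 1) => Fin (550 * d) → unitInterval) (Fin.last n)).symm (u, r) with hw
      have h1 : w (Fin.last n) = u := by
        simp [hw, MeasurableEquiv.piFinSuccAbove]
      have h2 : (fun i : Fin n => w i.castSucc) = r := by
        funext i
        simp [hw, MeasurableEquiv.piFinSuccAbove]
      rw [afterRounds_succ_val, afterRounds_castSucc, h2]
      exact congrArg (fun v => (round L S v (afterRounds L S r n le_rfl).val).val) h1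
    simp only [Function.comp_apply, hstep]
    calc _ ≤ ∫⁻ r : Fin n → Fin (550 * d) → unitInterval,
          3 / 4 * (2⁻¹ : ℝ≥0∞) ^ (afterRounds L S r n le_rfl).val.count :=
          lintegral_mono fun r => lintegral_round_le
            (invariant_afterRounds hc hS (by omega) r n le_rfl) hd hH hL hc hS
      _ ≤ 3 / 4 * (3 / 4) ^ n := by
          rw [lintegral_const_mul' _ _ (by finiteness)]
          gcongr
      _ = _ := (pow_succ' _ _).symm

/-- The lower tail of the number of successful rounds. -/
lemma volume_count_lt_le (hd : 1 ≤ d) (hH : HasVCDim H d) (hL : L.IsERM H) (hc : c ∈ H)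
    (hS : RealizedBy S c) {N : ℕ} (hN : 6 * N ≤ n) :
    volume {r : Fin n → Fin (550 * d) → unitInterval |
      (afterRounds L S r n le_rfl).val.count < N} ≤ ENNReal.ofReal (Real.exp (-1 / 10) ^ N) := by
  have hel : IsElementary fun r : Fin n → Fin (550 * d) → unitInterval =>
      (2⁻¹ : ℝ≥0∞) ^ (afterRounds L S r n le_rfl).val.count :=
    (isElementary_afterRounds L S n le_rfl).comp fun x => 2⁻¹ ^ x.val.count
  have hmarkov := (mul_meas_ge_le_lintegral (μ := volume) hel.measurable (2⁻¹ ^ N)).trans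
    (lintegral_count_le (n := n) hd hH hL hc hS)
  have hsub : {r : Fin n → Fin (550 * d) → unitInterval |
      (afterRounds L S r n le_rfl).val.count < N} ⊆
      {r | (2⁻¹ : ℝ≥0∞) ^ N ≤ 2⁻¹ ^ (afterRounds L S r n le_rfl).val.count} := fun r hr =>
    pow_le_pow_right_of_le_one' (ENNReal.inv_le_one.2 one_le_two) (le_of_lt hr)
  have hcancel : (2 : ℝ≥0∞) ^ N * 2⁻¹ ^ N = 1 := by
    rw [← mul_pow, ENNReal.mul_inv_cancel (by simp) (by simp), one_pow]
  have hnum : (2 : ℝ) * (3 / 4) ^ 6 ≤ Real.exp (-1 / 10) := by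
    refine le_trans ?_ (Real.add_one_le_exp _)
    norm_num
  calc _ ≤ volume {r : Fin n → Fin (550 * d) → unitInterval |
        (2⁻¹ : ℝ≥0∞) ^ N ≤ 2⁻¹ ^ (afterRounds L S r n le_rfl).val.count} := measure_mono hsub
    _ = 2 ^ N * (2⁻¹ ^ N * volume {r : Fin n → Fin (550 * d) → unitInterval |
        (2⁻¹ : ℝ≥0∞) ^ N ≤ 2⁻¹ ^ (afterRounds L S r n le_rfl).val.count}) := by
        rw [← mul_assoc, hcancel, one_mul]
    _ ≤ 2 ^ N * (3 / 4) ^ n := by gcongr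
    _ ≤ 2 ^ N * (3 / 4) ^ (6 * N) := by
        have : (3 / 4 : ℝ≥0∞) ≤ 1 := ENNReal.div_le_of_le_mul (by norm_num)
        exact mul_le_mul_right (pow_le_pow_right_of_le_one' this hN) _
    _ = ENNReal.ofReal ((2 * (3 / 4) ^ 6) ^ N) := by
        rw [pow_mul, ← mul_pow, ENNReal.ofReal_pow (by positivity),
          ENNReal.ofReal_mul (by positivity), ENNReal.ofReal_pow (by positivity),
          ENNReal.ofReal_div_of_pos (by norm_num)]
        norm_num
    _ ≤ _ := ENNReal.ofReal_le_ofReal (pow_le_pow_left₀ (by positivity) hnum N)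

end Law

/-! ### The returned vote -/

section Vote

variable {X M : Type*} {m n s t : ℕ}

/-- The part of the algorithm after the boosting rounds. -/
noncomputable def finish (L : Learner X M) (S : Fin m → X × ℤˣ) (st : State M m t) :
    Timed (Output M t) :=
  (ops 1 ()).bind fun _ =>
  if t ≤ st.count then
    (forLoop t (fun _ => none) fun j f => ops 2 (Function.update f j (st.hf j))).bind fun f =>
    (marginErrors L S f).bind fun bad =>
    (ops 3 ()).bind fun _ =>
    if (bad : ℝ) / (m : ℝ) < 1 / (m : ℝ) then ops 1 (Output.boosted f)
    else runFallback L S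
  else runFallback L S

lemma forLoop_copy_val (f : Fin t → Option M) :
    (forLoop t (fun _ => none) fun j g => ops 2 (Function.update g j (f j))).val = f :=
  forLoop_update_val _ _ _ fun _ _ _ => rfl

lemma finish_val (hm : 0 < m) {L : Learner X M} {S : Fin m → X × ℤˣ} {st : State M m t}
    (hc : t ≤ st.count) (hS : ∀ i, theta < margin L st.hf (S i) / t) :
    (finish L S st).val = Output.boosted st.hf := by
  have hm' : (0 : ℝ) < m := by exact_mod_cast hm
  rw [finish, bind_val, if_pos hc, bind_val, bind_val, bind_val, forLoop_copy_val,
    marginErrors_val_eq_zero L S _ hS, if_pos (by simpa using hm'), ops_val]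

lemma runFallback_val_ne (L : Learner X M) (S : Fin m → X × ℤˣ) (f : Fin t → Option M) :
    (runFallback L S).val ≠ Output.boosted f := by
  rw [runFallback, bind_val, ops_val]
  exact fun h => nomatch h

lemma finish_cost_le {L : Learner X M} {S : Fin m → X × ℤˣ} {st : State M m t} {I : ℕ}
    (hI : ∀ j h, st.hf j = some h → ∀ x, (L.infer h x).cost ≤ I)
    (hb : ∃ f, (finish L S st).val = Output.boosted f) :
    (finish L S st).cost ≤ 5 + 4 * t + m * (t * (I + 7) + 5) := by
  obtain ⟨f, hf⟩ := hb
  by_cases hc : t ≤ st.count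
  · have h1 := marginErrors_cost_le L S st.hf hI
    have h2 := forLoop_cost_le t (fun _ => none)
      (fun j g => ops 2 (Function.update g j (st.hf j))) 2 fun _ _ => le_rfl
    rw [finish, bind_val, if_pos hc, bind_val, bind_val, bind_val, forLoop_copy_val] at hf
    rw [finish, bind_cost, if_pos hc, bind_cost, bind_cost, bind_cost, forLoop_copy_val]
    split_ifs at hf ⊢ with h3
    · simp only [ops_cost]
      omega
    · exact absurd hf (runFallback_val_ne L S f)
  · rw [finish, bind_val, if_neg hc] at hf
    exact absurd hf (runFallback_val_ne L S f)

variable [NeZero m]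

lemma adaBoostSample_val (L : Learner X M) (S : Fin m → X × ℤˣ)
    (r : Fin n → Fin s → unitInterval) :
    (adaBoostSample L S r).val = (finish L S (afterRounds L S r n le_rfl).val).val := by
  rw [adaBoostSample, bind_val, bind_val, finish]

lemma adaBoostSample_cost (L : Learner X M) (S : Fin m → X × ℤˣ)
    (r : Fin n → Fin s → unitInterval) :
    (adaBoostSample L S r).cost = m + n * s + ((afterRounds L S r n le_rfl).cost +
      (finish L S (afterRounds L S r n le_rfl).val).cost) := by
  rw [adaBoostSample, bind_cost, bind_cost, finish, ops_cost]

/-- The counter counts the successful rounds, and the voter at position `l` is the model of the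
successful round that is preceded by exactly `l` successful rounds. -/
lemma afterRounds_count_and_hf (L : Learner X M) (S : Fin m → X × ℤˣ)
    (r : Fin n → Fin s → unitInterval) {p : ℕ → Prop} [DecidablePred p]
    (hp : ∀ i (hi : i < n), p i ↔
      RoundSucceeds L S (r ⟨i, hi⟩) (afterRounds L S r i hi.le).val) (k : ℕ) (hk : k ≤ n) :
    (afterRounds L S r k hk).val.count = Nat.count p k ∧
      ∀ i (hi : i < n), i < k → p i → ∀ l : Fin (numVoters m), (l : ℕ) = Nat.count p i →
        (afterRounds L S r k hk).val.hf l = some (roundModel L S r ⟨i, hi⟩) := by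
  induction k with
  | zero => exact ⟨by rw [afterRounds_zero_val, initState_val]; simp, fun i _ hi => by omega⟩
  | succ k ih =>
    obtain ⟨ih1, ih2⟩ := ih (Nat.le_of_succ_le hk)
    rw [afterRounds_succ_val]
    set st := (afterRounds L S r k (Nat.le_of_succ_le hk)).val with hst
    rw [Nat.count_succ]
    by_cases hs : RoundSucceeds L S (r ⟨k, hk⟩) st
    · have hpk : p k := (hp k hk).2 hs
      refine ⟨by rw [round_count_of_succeeds hs, ih1, if_pos hpk], fun i hi hik hpi l hl => ?_⟩
      rcases Nat.lt_or_ge i k with hlt | hge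
      · have h1 : Nat.count p i < Nat.count p k := Nat.count_strict_mono hpi hlt
        rcases lt_or_ge st.count (numVoters m) with hc | hc
        · rw [round_hf_of_succeeds hs hc, Function.update_of_ne, ih2 i hi hlt hpi l hl]
          rintro rfl
          simp only at hl
          omega
        · rw [round_hf_of_full hc, ih2 i hi hlt hpi l hl]
      · obtain rfl : i = k := by omega
        have hc : st.count < numVoters m := by rw [ih1, ← hl]; exact l.isLt
        have h2 : l = ⟨st.count, hc⟩ := Fin.ext (hl.trans ih1.symm)
        rw [round_hf_of_succeeds hs hc, h2, Function.update_self]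
        rfl
    · have hpk : ¬ p k := fun h => hs ((hp k hk).1 h)
      refine ⟨by rw [round_count_of_not_succeeds hs, ih1, if_neg hpk, add_zero],
        fun i hi hik hpi l hl => ?_⟩
      have hne : i ≠ k := by rintro rfl; exact hpk hpi
      rw [round_hf_of_not_succeeds hs, ih2 i hi (by omega) hpi l hl]

/-- Enough successful rounds make the algorithm return the vote of the models of such rounds. -/
lemma boostingSucceeds_of_le_count {L : Learner X M} {S : Fin m → X × ℤˣ} {H : Set (X → ℤˣ)}
    {c : X → ℤˣ} (hm : 2 ≤ m) (hc : c ∈ H) (hS : RealizedBy S c) (hs : 1 ≤ s)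
    (r : Fin n → Fin s → unitInterval)
    (hcount : numVoters m ≤ (afterRounds L S r n le_rfl).val.count) : BoostingSucceeds L S r := by
  classical
  obtain ⟨p, hp⟩ : ∃ p : ℕ → Prop, ∀ i, p i ↔ ∃ hi : i < n,
    RoundSucceeds L S (r ⟨i, hi⟩) (afterRounds L S r i hi.le).val := ⟨_, fun _ => Iff.rfl⟩
  obtain ⟨h1, h2⟩ := afterRounds_count_and_hf L S r (p := p)
    (fun i hi => (hp i).trans ⟨fun h => h.2, fun h => ⟨hi, h⟩⟩) n le_rfl
  rw [h1] at hcount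
  have hlt : ∀ j : Fin (numVoters m), (j : ℕ) < Nat.count p n := fun j =>
    j.isLt.trans_le hcount
  have hcard : ∀ j : Fin (numVoters m), ∀ hf : (Set.ofPred p).Finite, (j : ℕ) < hf.toFinset.card :=
    fun j hf => (hlt j).trans_le (Nat.count_le_card hf n)
  have hmem : ∀ j : Fin (numVoters m), p (Nat.nth p j) := fun j => Nat.nth_mem _ (hcard j)
  have hcn : ∀ j : Fin (numVoters m), Nat.count p (Nat.nth p j) = j := fun j =>
    Nat.count_nth (hcard j)
  refine ⟨fun j => ⟨Nat.nth p j, Nat.nth_lt_of_lt_count (hlt j)⟩, fun a b hab => ?_,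
    fun j => ?_, ?_⟩
  · refine (Nat.count_monotone p).reflect_lt ?_
    rw [hcn, hcn]
    exact hab
  · obtain ⟨hi, hsucc⟩ := (hp _).1 (hmem j)
    rw [RoundSucceeds, half_sub_gamma] at hsucc
    exact hsucc
  · rw [adaBoostSample_val, finish_val (by omega) (by rw [h1]; exact hcount)
      ((invariant_afterRounds hc hS hs r n le_rfl).theta_lt_margin hm (by rw [h1]; exact hcount))]
    congr 1
    funext j
    exact h2 _ _ (Nat.nth_lt_of_lt_count (hlt j)) (hmem j) j (hcn j).symm

end Vote

/-! ### The number of operations -/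

section Cost

variable {X M : Type*} {m n s t : ℕ} {L : Learner X M} {S : Fin m → X × ℤˣ} {H : Set (X → ℤˣ)}
  {c : X → ℤˣ}

lemma round_cost_le [NeZero m] {st : State M m t} {u : Fin s → unitInterval} {p T I : ℕ}
    (hp : m ≤ 2 ^ p) (hT : ∀ idx : Fin s → Fin m, (L.train fun j => S (idx j)).cost ≤ T)
    (hI : ∀ x, (L.infer (drawnModel L S st.C u) x).cost ≤ I) :
    (round L S u st).cost ≤ s * (7 * p + 5) + T + 2 * (m * I) + 32 * m + 29 := by
  have h1 := drawIndices_cost_le st.C u hp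
  have h2 := hT (drawIndices st.C u).val
  have h3 := computeError_cost_le L S st.D _ hI
  have h4 := fun ε γ => register_cost_le st (drawnModel L S st.C u) ε γ
  have h5 := fun α => reweight_cost_le L S st.D _ α hI
  have h6 := fun D : Fin m → ℝ => total_cost_le D
  have h7 := fun (D : Fin m → ℝ) Z => normalize_cost_le D Z
  have h8 := fun D : Fin m → ℝ => cumulate_cost_le D
  unfold drawnModel at h3 h4 h5
  have key : ∀ a b c' d e f g h : ℕ, a ≤ s * (7 * p + 5) → b ≤ T → c' ≤ m * (I + 6) → d ≤ 24 →
      e ≤ m * (I + 11) → f ≤ m * 4 → g ≤ m * 5 → h ≤ m * 6 →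
      a + (b + (c' + (1 + (d + (e + (f + (4 + (g + (h + 0)))))))))
        ≤ s * (7 * p + 5) + T + 2 * (m * I) + 32 * m + 29 := by
    intro a b c' d e f g h ha hb hc hd he hf hg hh
    rw [mul_add] at hc he
    omega
  rw [round, bind_cost, bind_cost, bind_cost, bind_cost, bind_cost, bind_cost, bind_cost,
    bind_cost, bind_cost, bind_cost, ops_cost, ops_cost, ops_cost]
  exact key _ _ _ _ _ _ _ _ h1 h2 h3 (h4 _ _) (h5 _) (h6 _) (h7 _ _) (h8 _)

lemma afterRounds_cost_le [NeZero m] {p T I : ℕ} (hc : c ∈ H) (hS : RealizedBy S c) (hs : 1 ≤ s)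
    (hp : m ≤ 2 ^ p) (hT : ∀ idx : Fin s → Fin m, (L.train fun j => S (idx j)).cost ≤ T)
    (hI : ∀ h, IsTrained L H h → ∀ x, (L.infer h x).cost ≤ I)
    (r : Fin n → Fin s → unitInterval) :
    (afterRounds L S r n le_rfl).cost ≤ 10 * m + 8 + 6 * numVoters m +
      n * (s * (7 * p + 5) + T + 2 * (m * I) + 32 * m + 31) := by
  have h := (forLoop_spec (fun _ st => Invariant L H S st)
    (s * (7 * p + 5) + T + 2 * (m * I) + 32 * m + 29) n (initState M m (numVoters m)).val
    (fun i st => round L S (r (Fin.castLE le_rfl i)) st) invariant_initState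
    fun i st hst => ⟨hst.round hc hS hs _, round_cost_le hp hT
      (hI _ (isTrained_drawnModel hc hS hs _ _))⟩).2
  rw [afterRounds, bind_cost]
  exact Nat.add_le_add initState_cost_le h

lemma exists_nat_le_of_ne_top {x : ℝ≥0∞} (hx : x ≠ ⊤) :
    ∃ N : ℕ, (N : ℝ≥0∞) ≤ x ∧ ∀ k : ℕ, (k : ℝ≥0∞) ≤ x → k ≤ N := by
  refine ⟨⌊x.toReal⌋₊, ?_, fun k hk => Nat.le_floor ?_⟩
  · rw [← ENNReal.toReal_le_toReal (by simp) hx, ENNReal.toReal_natCast]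
    exact Nat.floor_le ENNReal.toReal_nonneg
  · rw [← ENNReal.toReal_natCast]
    exact ENNReal.toReal_mono hx hk

/-- The depth of the binary search is at most `3 ln m`. -/
lemma log_two_succ_le (hm : 2 ≤ m) : ((Nat.log 2 m + 1 : ℕ) : ℝ) ≤ 3 * Real.log m := by
  have hm0 : (0 : ℝ) < m := by exact_mod_cast (by omega : 0 < m)
  have h1 : (Nat.log 2 m : ℝ) * Real.log 2 ≤ Real.log m := by
    rw [← Real.log_pow]
    refine Real.log_le_log (by positivity) ?_
    exact_mod_cast Nat.pow_log_le_self 2 (by omega)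
  have h2 : Real.log 2 ≤ Real.log m := Real.log_le_log two_pos (by exact_mod_cast hm)
  have h3 := Real.log_two_gt_d9
  have h4 : (2 / 3 : ℝ) ≤ Real.log 2 := by linarith
  have h5 : (Nat.log 2 m + 1 : ℝ) * (2 / 3) ≤ (Nat.log 2 m + 1 : ℝ) * Real.log 2 :=
    mul_le_mul_of_nonneg_left h4 (by positivity)
  push_cast
  linarith

/-- A run that returns the boosted vote respects the cost bound, whatever the random string. The
constant is `550 * 30`: the `550 d` binary searches of a round take `550 d (7 p + 6)` steps in all,
with depth `p ≤ 3 ln m` and `6 ≤ 9 ln m`. -/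
lemma adaBoostSample_cost_le [NeZero m] {d : ℕ} (hd : 1 ≤ d) (hm : 2 ≤ m) (hc : c ∈ H)
    (hS : RealizedBy S c) (hn : numVoters m ≤ n) (r : Fin n → Fin (550 * d) → unitInterval)
    (hb : ∃ f, (adaBoostSample L S r).val = Output.boosted f) :
    ((adaBoostSample L S r).cost : ℝ≥0∞) ≤ costBound L H d m n 16500 := by
  have hn1 : 1 ≤ n := (numVoters_pos hm).trans_le hn
  have hn0 : (n : ℝ≥0∞) ≠ 0 := by exact_mod_cast (by omega : n ≠ 0)
  have hm0 : (m : ℝ≥0∞) ≠ 0 := by exact_mod_cast (by omega : m ≠ 0)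
  unfold costBound
  -- an infinite training or inference cost makes the bound infinite; otherwise both costs are
  -- bounded by natural numbers, and the steps are counted in `ℕ`
  by_cases hTtop : L.trainCost H (550 * d) = ⊤
  · rw [hTtop, add_top, top_add, ENNReal.mul_top hn0]
    exact le_top
  by_cases hItop : L.inferCost H = ⊤
  · rw [hItop, ENNReal.mul_top (mul_ne_zero (by simp) hm0), add_top, ENNReal.mul_top hn0]
    exact le_top
  obtain ⟨T, hTle, hT⟩ := exists_nat_le_of_ne_top hTtop
  obtain ⟨I, hIle, hI⟩ := exists_nat_le_of_ne_top hItop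
  have hT' : ∀ idx : Fin (550 * d) → Fin m, (L.train fun j => S (idx j)).cost ≤ T := fun idx =>
    hT _ (le_iSup₂_of_le (fun j => S (idx j)) ⟨c, hc, fun _ => hS _⟩ le_rfl)
  have hI' : ∀ h, IsTrained L H h → ∀ x, (L.infer h x).cost ≤ I := by
    rintro h ⟨k, S', hk, hS', rfl⟩ x
    refine hI _ ?_
    unfold Learner.inferCost
    exact le_iSup_of_le k (le_iSup_of_le hk (le_iSup_of_le S' (le_iSup_of_le hS'
      (le_iSup_of_le x le_rfl))))
  have hs : 1 ≤ 550 * d := by omega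
  set p := Nat.log 2 m + 1 with hp
  have hround := afterRounds_cost_le hc hS hs (Nat.lt_pow_succ_log_self one_lt_two m).le hT' hI' r
  have hfin := finish_cost_le (L := L) (S := S) (st := (afterRounds L S r n le_rfl).val)
    (fun j h hj => hI' h ((invariant_afterRounds hc hS hs r n le_rfl).hf_trained j h hj))
    (by rwa [adaBoostSample_val] at hb)
  rw [Nat.succ_eq_add_one, ← hp] at hround
  -- all terms that do not depend on `T` and `I` are absorbed by `109 * m` per round
  have hnat : (adaBoostSample L S r).cost
      ≤ n * (550 * d * (7 * p + 6) + 109 * m + T + 3 * m * I) := by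
    rw [adaBoostSample_cost]
    have h1 : m * (numVoters m * (I + 7) + 5) ≤ m * (n * (I + 7) + 5) := by gcongr
    have h2 : m ≤ n * m := Nat.le_mul_of_pos_left m hn1
    have h3 : n ≤ n * m := Nat.le_mul_of_pos_right n (by omega)
    calc _ ≤ m + n * (550 * d) + ((10 * m + 8 + 6 * numVoters m +
          n * (550 * d * (7 * p + 5) + T + 2 * (m * I) + 32 * m + 31)) +
          (5 + 4 * numVoters m + m * (numVoters m * (I + 7) + 5))) := by gcongr
      _ ≤ m + n * (550 * d) + ((10 * m + 8 + 6 * n +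
          n * (550 * d * (7 * p + 5) + T + 2 * (m * I) + 32 * m + 31)) +
          (5 + 4 * n + m * (n * (I + 7) + 5))) := by gcongr
      _ ≤ _ := by nlinarith
  have hreal : ((550 * d * (7 * p + 6) + 109 * m : ℕ) : ℝ)
      ≤ 16500 * ((m : ℝ) + (d : ℝ) * Real.log m) := by
    have h1 := log_two_succ_le hm
    rw [← hp] at h1
    have h2 : (2 / 3 : ℝ) ≤ Real.log m := by
      have h3 := Real.log_two_gt_d9
      have h4 : Real.log 2 ≤ Real.log m := Real.log_le_log two_pos (by exact_mod_cast hm)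
      linarith
    have h3 : (d : ℝ) * (7 * p + 6) ≤ d * (30 * Real.log m) :=
      mul_le_mul_of_nonneg_left (by linarith) (by positivity)
    have h4 : (0 : ℝ) ≤ m := by positivity
    push_cast
    linarith
  calc ((adaBoostSample L S r).cost : ℝ≥0∞)
      ≤ ((n * (550 * d * (7 * p + 6) + 109 * m + T + 3 * m * I) : ℕ) : ℝ≥0∞) := by
        exact_mod_cast hnat
    _ = (n : ℝ≥0∞) * (((550 * d * (7 * p + 6) + 109 * m : ℕ) : ℝ≥0∞) + T + 3 * m * I) := by
        push_cast; ring
    _ ≤ _ := by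
        gcongr
        rw [← ENNReal.ofReal_natCast]
        exact ENNReal.ofReal_le_ofReal hreal

end Cost

end AdaBoostSample

open AdaBoostSample in
theorem mainTheorem4 :
    ∃ K : ℝ, 0 < K ∧
      ∀ (X : Type*) (M : Type*) (H : Set (X → ℤˣ)) (d : ℕ) (L : Learner X M) (c : X → ℤˣ)
        (m n : ℕ) [NeZero m] (S : Fin m → X × ℤˣ) (δ : ℝ),
        1 ≤ d → HasVCDim H d → L.IsERM H → c ∈ H →
        2 ≤ m → RealizedBy S c → 0 < δ → δ < 1 →
        6 * ⌈(20 : ℝ) ^ 2 * Real.log (8 * (m : ℝ) / δ) / 2⌉₊ ≤ n →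
        MeasurableSet {r : Fin n → Fin (550 * d) → unitInterval |
          BoostingSucceeds L S r ∧
            ((adaBoostSample L S r).cost : ℝ≥0∞) ≤ costBound L H d m n K} ∧
        1 - (δ / (8 * (m : ℝ))) ^ 20 ≤
          (volume : Measure (Fin n → Fin (550 * d) → unitInterval)).real
            {r | BoostingSucceeds L S r ∧
              ((adaBoostSample L S r).cost : ℝ≥0∞) ≤ costBound L H d m n K} ∧
        ∀ r : Fin n → Fin (550 * d) → unitInterval,
          (∃ f, (adaBoostSample L S r).val = Output.boosted f) →
            ((adaBoostSample L S r).cost : ℝ≥0∞) ≤ costBound L H d m n K := by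
  refine ⟨16500, by norm_num, ?_⟩
  intro X M H d L c m n _ S δ hd hH hL hc hm hS hδ0 hδ1 hn
  have hm1 : (1 : ℝ) ≤ m := by exact_mod_cast (by omega : 1 ≤ m)
  have hm0 : (0 : ℝ) < m := by linarith
  set N := ⌈(20 : ℝ) ^ 2 * Real.log (8 * (m : ℝ) / δ) / 2⌉₊ with hN
  have hmδ : (m : ℝ) ≤ 8 * m / δ := by
    rw [le_div_iff₀ hδ0]
    nlinarith
  have htN : numVoters m ≤ N := by
    refine Nat.ceil_le_ceil ?_
    have := Real.log_le_log hm0 hmδ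
    linarith
  have htn : numVoters m ≤ n := by omega
  have hmeas := measurableSet_boostingSucceeds_and (n := n) (s := 550 * d) L S
    fun x => (x.cost : ℝ≥0∞) ≤ costBound L H d m n 16500
  refine ⟨hmeas, ?_, fun r hb => adaBoostSample_cost_le hd hm hc hS htn r hb⟩
  have hsub : {r : Fin n → Fin (550 * d) → unitInterval | BoostingSucceeds L S r ∧
      ((adaBoostSample L S r).cost : ℝ≥0∞) ≤ costBound L H d m n 16500}ᶜ ⊆
      {r | (afterRounds L S r n le_rfl).val.count < N} := by
    intro r hr
    by_contra hcount
    have hsucc := boostingSucceeds_of_le_count hm hc hS (by omega : 1 ≤ 550 * d) r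
      (htN.trans (not_lt.1 hcount))
    refine hr ⟨hsucc, adaBoostSample_cost_le hd hm hc hS htn r ?_⟩
    obtain ⟨i, -, -, hi⟩ := hsucc
    exact ⟨_, hi⟩
  have hvol := (measure_mono (μ := volume) hsub).trans (volume_count_lt_le hd hH hL hc hS hn)
  have hreal := ENNReal.toReal_le_of_le_ofReal (by positivity) hvol
  have hcompl := probReal_compl_eq_one_sub (μ := volume) hmeas
  rw [measureReal_def] at hcompl
  have hexp : Real.exp (-1 / 10) ^ N ≤ (δ / (8 * (m : ℝ))) ^ 20 := by
    have h1 : 200 * Real.log (8 * (m : ℝ) / δ) ≤ N :=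
      le_trans (le_of_eq (by ring)) (Nat.le_ceil _)
    have h2 : (δ / (8 * (m : ℝ))) = Real.exp (-Real.log (8 * (m : ℝ) / δ)) := by
      rw [Real.exp_neg, Real.exp_log (by positivity), inv_div]
    rw [h2, ← Real.exp_nat_mul, ← Real.exp_nat_mul]
    refine Real.exp_le_exp.2 ?_
    push_cast
    linarith
  linarith
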